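/- Let $n\ge 2$, let $\Omega\subseteq\mathbb{R}^n$ be open, let $\nu, C_1,\dots,C_{n-2},C_{n-1}=H:\Omega\to\mathbb{R}$ be smooth, and let $X$ be the vector field on $\Omega$ with components $$X_i=\nu\cdot\frac{\partial(C_1,\dots,C_{n-2},x_i,H)}{\partial(x_1,\dots,x_n)},\qquad 1\le i\le n,$$ that is, the Hamiltonian vector field of $H$ for the Poisson bracket $\{f,g\}\,dx_1\wedge\dots\wedge dx_n=\nu\, dC_1\wedge\dots\wedge dC_{n-2}\wedge df\wedge dg$. Let $$\mathcal{E}=\{x\in\Omega : \nu(x)\ne 0,\ \nabla C_1(x)\wedge\dots\wedge\nabla C_{n-2}(x)\neq 0,\ \nabla C_1(x)\wedge\dots\wedge\nabla C_{n-2}(x)\wedge\nabla H(x)=0\}$$ be the set of regular equilibria of $X$ (the empty wedge product, for $n=2$, is $1$). For $\lambda\in\mathbb{R}^{n-2}$ put $F_\lambda=H+\lambda_1C_1+\dots+\lambda_{n-2}C_{n-2}$. A point $x\in\mathcal{E}$ is called non-degenerate if it is a non-degenerate critical point of $F_\lambda$ for some (necessarily unique) $\lambda$, i.e. $\nabla F_\lambda(x)=0$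 and $\det\operatorname{Hess}F_\lambda(x)\ne 0$; in that case put $$\mathcal{I}_X(x)=\nu(x)^2\,\det(\operatorname{Hess}F_\lambda(x))\,\Big\langle \bigwedge_{i=1}^{n-2}[\operatorname{Hess}F_\lambda(x)]^{-1}\nabla C_i(x),\ \bigwedge_{i=1}^{n-2}\nabla C_i(x)\Big\rangle_{n-2},$$ where $\langle u_1\wedge\dots\wedge u_k,v_1\wedge\dots\wedge v_k\rangle_k=\det[\langle u_i,v_j\rangle]$. An equilibrium $x\in\Omega$ of $X$ is Lyapunov stable if for every open neighborhood $U\subseteq\Omega$ of $x$ there is an open neighborhood $W\subseteq U$ of $x$ such that every integral curve of $X$ starting in $W$ exists and stays in $U$ for all $t\ge 0$; otherwise it is unstable. Let $\bar x_e\in\mathcal{E}$ be non-degenerate, and let $\lambda_e\in\mathbb{R}^{n-2}$ be such that $\bar x_e$ is a non-degenerate critical point of $F_{\lambda_e}$. Then: 1. If $\mathcal{I}_X(\bar x_e)<0$, there exist an open neighborhood $V\subseteq\mathbb{R}^{n-2}$ of $\lambda_e$, an open neighborhood $U\subseteq\Omega$ of $\bar x_e$, and a smooth function $\bar x:V\to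 U$ with $\bar x(\lambda_e)=\bar x_e$, such that for every $\lambda\in V$ the point $\bar x(\lambda)\in\mathcal{E}\cap U$ is an unstable non-degenerate regular equilibrium of $X$, and is a non-degenerate critical point of $F_\lambda$. 2. If $\mathcal{I}_X(\bar x_e)>0$, there exist an open neighborhood $V\subseteq\mathbb{R}^{n-2}$ of $\lambda_e$, an open neighborhood $U\subseteq\Omega$ of $\bar x_e$, and a smooth function $\bar x:V\to U$ with $\bar x(\lambda_e)=\bar x_e$, such that for every $\lambda\in V$ the point $\bar x(\lambda)\in\mathcal{E}\cap U$ is a Lyapunov stable non-degenerate regular equilibrium of $X$, and is a non-degenerate critical point of $F_\lambda$. -/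

import Mathlib

open scoped ContDiff Gradient

noncomputable section

/-- The Euclidean space `ℝᵏ`. -/
abbrev RVec (k : ℕ) : Type := EuclideanSpace ℝ (Fin k)

/-- The Jacobian determinant `∂(f₁, …, f_k) / ∂(x₁, …, x_k)` at the point `x`. -/
def jacobianDet {k : ℕ} (f : Fin k → RVec k → ℝ) (x : RVec k) : ℝ :=
  Matrix.det (Matrix.of fun i j : Fin k =>
    fderiv ℝ (f i) x (EuclideanSpace.single j (1 : ℝ)))

/-- The canonical Hessian operator `v ↦ D(∇F)(x) v` of `F` at `x`. -/
def hessian {k : ℕ} (F : RVec k → ℝ) (x : RVec k) : RVec k →L[ℝ] RVec k :=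
  fderiv ℝ (∇ F) x

/-- `x` is a non-degenerate critical point of `F`. -/
def IsNondegenerateCriticalPoint {k : ℕ} (F : RVec k → ℝ) (x : RVec k) : Prop :=
  ∇ F x = 0 ∧ (hessian F x).det ≠ 0

/-- The decomposable multivector `u₁ ∧ ⋯ ∧ u_j`; the exterior power carries the inner product
`⟪u₁ ∧ ⋯ ∧ u_j, v₁ ∧ ⋯ ∧ v_j⟫ = det [⟪u_a, v_b⟫]`
(`exteriorPower.inner_ιMulti_ιMulti`). -/
abbrev wedge {k j : ℕ} (u : Fin j → RVec k) : ⋀[ℝ]^j (RVec k) :=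
  exteriorPower.ιMulti ℝ j u

/-- The equilibrium `x` of the vector field `X` on the open set `Ω` is Lyapunov stable: for every
open neighbourhood `U ⊆ Ω` of `x` there is an open neighbourhood `W ⊆ U` of `x` such that every
integral curve of `X` starting in `W` is defined and stays in `U` for all times `t ≥ 0`.
(For a smooth `X` the integral curve `γ` with `γ 0 = y` is unique, so it is `t ↦ F_t(y)`, with
`F` the flow of `X`.) -/
def IsLyapunovStable {k : ℕ} (Ω : Set (RVec k)) (X : RVec k → RVec k) (x : RVec k) : Prop :=
  X x = 0 ∧
    ∀ U : Set (RVec k), IsOpen U → U ⊆ Ω → x ∈ U →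
      ∃ W : Set (RVec k), IsOpen W ∧ W ⊆ U ∧ x ∈ W ∧
        ∀ y ∈ W, ∃ γ : ℝ → RVec k, γ 0 = y ∧
          IsIntegralCurveOn γ (fun _ => X) (Set.Ici 0) ∧ ∀ t : ℝ, 0 ≤ t → γ t ∈ U

/-- An unstable equilibrium: an equilibrium which is not Lyapunov stable. -/
def IsUnstableEquilibrium {k : ℕ} (Ω : Set (RVec k)) (X : RVec k → RVec k) (x : RVec k) :
    Prop :=
  X x = 0 ∧ ¬ IsLyapunovStable Ω X x

/-- The data of a Hamilton-Poisson realization `(Ω, {·,·}_{ν; C₁, …, C_{n-2}}, H = C_{n-1})` of a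
completely integrable system on an open subset `Ω` of `ℝⁿ`, where `n = m + 2`. The values of the
functions outside `Ω` play no role. -/
structure HamiltonianRealization (m : ℕ) where
  /-- the domain -/
  Ω : Set (RVec (m + 2))
  /-- the rescaling function -/
  ν : RVec (m + 2) → ℝ
  /-- the first integrals `C₁, …, C_{n-2}` (Casimir functions of the bracket) -/
  C : Fin m → RVec (m + 2) → ℝ
  /-- the Hamiltonian `H = C_{n-1}` -/
  H : RVec (m + 2) → ℝ
  isOpen_Ω : IsOpen Ω
  contDiffOn_ν : ContDiffOn ℝ ∞ ν Ω
  contDiffOn_C : ∀ i, ContDiffOn ℝ ∞ (C i) Ω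
  contDiffOn_H : ContDiffOn ℝ ∞ H Ω

namespace HamiltonianRealization

variable {m : ℕ} (S : HamiltonianRealization m)

/-- The Poisson bracket
`{f, g} dx₁ ∧ ⋯ ∧ dx_n = ν dC₁ ∧ ⋯ ∧ dC_{n-2} ∧ df ∧ dg`. -/
def bracket (f g : RVec (m + 2) → ℝ) (x : RVec (m + 2)) : ℝ :=
  S.ν x * jacobianDet
    (Fin.snoc (Fin.snoc S.C f : Fin (m + 1) → RVec (m + 2) → ℝ) g :
      Fin (m + 2) → RVec (m + 2) → ℝ) x

/-- The Hamiltonian vector field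
`X_i = {x_i, H} = ν ∂(C₁, …, C_{n-2}, x_i, H) / ∂(x₁, …, x_n)`. -/
def X (x : RVec (m + 2)) : RVec (m + 2) :=
  WithLp.toLp 2 fun i : Fin (m + 2) => S.bracket (fun y => y i) S.H x

/-- The set of regular equilibrium states: the points of `Ω` with `ν ≠ 0`,
`∇C₁ ∧ ⋯ ∧ ∇C_{n-2} ≠ 0` and `∇C₁ ∧ ⋯ ∧ ∇C_{n-2} ∧ ∇H = 0`. -/
def regularEquilibria : Set (RVec (m + 2)) :=
  {x | x ∈ S.Ω ∧ S.ν x ≠ 0 ∧ wedge (fun i : Fin m => ∇ (S.C i) x) ≠ 0 ∧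
    wedge (Fin.snoc (fun i : Fin m => ∇ (S.C i) x) (∇ S.H x) : Fin (m + 1) → RVec (m + 2)) = 0}

/-- The function `F_μ = H + μ₁ C₁ + ⋯ + μ_{n-2} C_{n-2}`. -/
def F (μ : RVec m) (x : RVec (m + 2)) : ℝ :=
  S.H x + ∑ i, μ i * S.C i x

/-- `x` is a non-degenerate regular equilibrium state. -/
def IsNondegenerateRegularEquilibrium (x : RVec (m + 2)) : Prop :=
  x ∈ S.regularEquilibria ∧ ∃ μ : RVec m, IsNondegenerateCriticalPoint (S.F μ) x

/-- The scalar quantity `I_X(x)` of a non-degenerate regular equilibrium state `x`: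
`ν(x)² · det Hess F_μ(x) · ⟪⋀ᵢ [Hess F_μ(x)]⁻¹ ∇Cᵢ(x), ⋀ᵢ ∇Cᵢ(x)⟫`,
where `μ` is the (unique) parameter for which `x` is a critical point of `F_μ`. -/
def invariant (μ : RVec m) (x : RVec (m + 2)) : ℝ :=
  S.ν x ^ 2 * (hessian (S.F μ) x).det *
    inner ℝ (wedge fun i : Fin m => (hessian (S.F μ) x).inverse (∇ (S.C i) x))
      (wedge fun i : Fin m => ∇ (S.C i) x)

end HamiltonianRealization

end

/-! Write `c` for the family of gradients of the Casimirs, `J = ν • hodgeMap c` for the Poisson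
operator and `A` for the Hessian of `F_μ`. Since `J` kills every `c i`, the field is `X = J ∇F_μ`
for every `μ`, so at a critical point of `F_μ` its linearization is `B = J A`.

Two determinant identities, `map_hodgeMap_map` and `hodgeMap_hodgeMap_hodgeMap`, give `B³ = -I_X B`
(`hodgeMap_comp_cube`). If `I_X < 0`, then `σ = √(-I_X)` is an eigenvalue of `B`: otherwise `J A J =
-σ J`, where the left side is symmetric and the right side is skew. A quadratic function that grows
along solutions inside a cone then rules out stability (`not_isLyapunovStable_of_cube_eq`).

If `I_X > 0`, linearization decides nothing. Instead, the sign of `I_X` is that of the determinant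
of the quadratic form of `A` on the plane orthogonal to `c`. Positivity makes this form definite
(`inner_map_self_ne_zero_of_pos`), so the equilibrium is isolated in the joint level set of `H` and
the Casimirs (`eventually_eq_of_mem_levelSet`). The sum of the squared increments of these first
integrals is then a Lyapunov function (`isLyapunovStable_of_firstIntegral`).

The branch of equilibria solves `∇F_μ(x) = 0` by the implicit function theorem. Along it `I_X` is
continuous and keeps its sign near `μ₀`, so the pointwise criteria apply at every point of the
branch (`exists_branch_of_isOpen`). -/

noncomputable section

/-! ### Determinants with two free slots -/

/-- The determinant of `k` vectors of `ℝᵏ`. -/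
def volForm (k : ℕ) : RVec k [⋀^Fin k]→ₗ[ℝ] ℝ :=
  Matrix.detRowAlternating.compLinearMap (WithLp.linearEquiv 2 ℝ (Fin k → ℝ)).toLinearMap

lemma volForm_apply {k : ℕ} (v : Fin k → RVec k) :
    volForm k v = Matrix.det (Matrix.of fun i j => v i j) := rfl

lemma volForm_mul_volForm {k : ℕ} (v w : Fin k → RVec k) :
    volForm k v * volForm k w = Matrix.det (Matrix.of fun i j => inner ℝ (v i) (w j)) := by
  rw [volForm_apply, volForm_apply, ← Matrix.det_transpose (Matrix.of fun i j => w i j),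
    ← Matrix.det_mul]
  congr 1
  ext i j
  simp [Matrix.mul_apply, PiLp.inner_apply, mul_comm]

lemma volForm_map {k : ℕ} (A : RVec k →L[ℝ] RVec k) (v : Fin k → RVec k) :
    volForm k (fun i => A (v i)) = A.det * volForm k v := by
  let b := (EuclideanSpace.basisFun (Fin k) ℝ).toBasis
  have h : volForm k = b.det := by
    ext v
    rw [volForm_apply, Module.Basis.det_apply, ← Matrix.det_transpose]
    congr 1
  rw [h]
  exact b.det_comp A.toLinearMap v

lemma volForm_ne_zero_iff {k : ℕ} {v : Fin k → RVec k} :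
    volForm k v ≠ 0 ↔ LinearIndependent ℝ v := by
  have : volForm k v ≠ 0 ↔ volForm k v * volForm k v ≠ 0 := by simp
  rw [this, volForm_mul_volForm, ← Matrix.det_gram_ne_zero_iff_linearIndependent (𝕜 := ℝ)]
  rfl

section

variable {m : ℕ}

/-- The family `c₁, …, c_m, u, w`. -/
abbrev snoc₂ {α : Type*} (c : Fin m → α) (u w : α) : Fin (m + 2) → α :=
  Fin.snoc (Fin.snoc c u : Fin (m + 1) → α) w

lemma snoc₂_eq_append {α : Type*} (c : Fin m → α) (u w : α) :
    snoc₂ c u w = Fin.append c ![u, w] := by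
  have h : (![u, w] : Fin 2 → α) = Fin.snoc (![u] : Fin 1 → α) w := by
    ext i; fin_cases i <;> rfl
  rw [h, Fin.append_snoc, Fin.append_right_eq_snoc]
  rfl

lemma snoc₂_eq_update_left {α : Type*} (c : Fin m → α) (a u w : α) :
    snoc₂ c u w = Function.update (snoc₂ c a w) (Fin.last m).castSucc u := by
  rw [snoc₂, snoc₂, ← Fin.snoc_update, Fin.update_snoc_last]

lemma snoc₂_eq_update_right {α : Type*} (c : Fin m → α) (u a w : α) :
    snoc₂ c u w = Function.update (snoc₂ c u a) (Fin.last (m + 1)) w := by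
  rw [snoc₂, snoc₂, Fin.update_snoc_last]

lemma map_snoc₂ {α β : Type*} (f : α → β) (c : Fin m → α) (u w : α) :
    (fun i => f (snoc₂ c u w i)) = snoc₂ (fun i => f (c i)) (f u) (f w) := by
  rw [snoc₂_eq_append, snoc₂_eq_append]
  ext i
  refine Fin.addCases (fun i => ?_) (fun i => ?_) i
  · simp
  · fin_cases i <;> simp

/-- The bilinear form `(u, w) ↦ det (c₁, …, c_m, u, w)`. -/
def volBilin (c : Fin m → RVec (m + 2)) : RVec (m + 2) →ₗ[ℝ] RVec (m + 2) →ₗ[ℝ] ℝ :=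
  LinearMap.mk₂ ℝ (fun u w => volForm (m + 2) (snoc₂ c u w))
    (fun u u' w => by
      simpa only [← snoc₂_eq_update_left] using
        (volForm (m + 2)).map_update_add (snoc₂ c 0 w) (Fin.last m).castSucc u u')
    (fun a u w => by
      simpa only [← snoc₂_eq_update_left] using
        (volForm (m + 2)).map_update_smul (snoc₂ c 0 w) (Fin.last m).castSucc a u)
    (fun u w w' => by
      simpa only [← snoc₂_eq_update_right] using
        (volForm (m + 2)).map_update_add (snoc₂ c u 0) (Fin.last (m + 1)) w w')
    (fun a u w => by
      simpa only [← snoc₂_eq_update_right] using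
        (volForm (m + 2)).map_update_smul (snoc₂ c u 0) (Fin.last (m + 1)) a w)

lemma volBilin_apply (c : Fin m → RVec (m + 2)) (u w : RVec (m + 2)) :
    volBilin c u w = volForm (m + 2) (snoc₂ c u w) := rfl

lemma volBilin_self (c : Fin m → RVec (m + 2)) (u : RVec (m + 2)) : volBilin c u u = 0 := by
  rw [volBilin_apply]
  refine (volForm (m + 2)).map_eq_zero_of_eq _ (i := (Fin.last m).castSucc)
    (j := Fin.last (m + 1)) ?_ (Fin.castSucc_lt_last _).ne
  simp [snoc₂]

lemma volBilin_swap (c : Fin m → RVec (m + 2)) (u w : RVec (m + 2)) :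
    volBilin c u w = -volBilin c w u := by
  have h := volBilin_self c (u + w)
  simp only [map_add, LinearMap.add_apply, volBilin_self] at h
  linarith

lemma volBilin_left_mem (c : Fin m → RVec (m + 2)) (i : Fin m) (w : RVec (m + 2)) :
    volBilin c (c i) w = 0 := by
  rw [volBilin_apply]
  refine (volForm (m + 2)).map_eq_zero_of_eq _ (i := i.castSucc.castSucc)
    (j := (Fin.last m).castSucc) ?_ ?_
  · simp [snoc₂]
  · simp

lemma volBilin_right_mem (c : Fin m → RVec (m + 2)) (i : Fin m) (u : RVec (m + 2)) :
    volBilin c u (c i) = 0 := by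
  rw [volBilin_swap, volBilin_left_mem, neg_zero]

lemma volBilin_map (A : RVec (m + 2) →L[ℝ] RVec (m + 2)) (c : Fin m → RVec (m + 2))
    (u w : RVec (m + 2)) :
    volBilin (fun i => A (c i)) (A u) (A w) = A.det * volBilin c u w := by
  rw [volBilin_apply, volBilin_apply, ← volForm_map, map_snoc₂]

/-- The product of two determinants is the determinant of mixed inner products. The orthogonality
hypotheses make the lower left block vanish, which leaves an `m × m` block times a `2 × 2` block. -/
lemma volBilin_mul_volBilin (c c' : Fin m → RVec (m + 2)) (u w u' w' : RVec (m + 2))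
    (hu : ∀ j, inner ℝ u (c' j) = 0) (hw : ∀ j, inner ℝ w (c' j) = 0) :
    volBilin c u w * volBilin c' u' w' =
      Matrix.det (Matrix.of fun i j => inner ℝ (c i) (c' j)) *
        (inner ℝ u u' * inner ℝ w w' - inner ℝ u w' * inner ℝ w u') := by
  rw [volBilin_apply, volBilin_apply, volForm_mul_volForm,
    ← Matrix.det_submatrix_equiv_self (finSumFinEquiv (m := m) (n := 2))]
  have h : (Matrix.of fun i j => inner ℝ (snoc₂ c u w i) (snoc₂ c' u' w' j)).submatrix
      (finSumFinEquiv (m := m) (n := 2)) (finSumFinEquiv (m := m) (n := 2)) =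
      Matrix.fromBlocks (Matrix.of fun i j => inner ℝ (c i) (c' j))
        (Matrix.of fun i j => inner ℝ (c i) (![u', w'] j)) 0
        (Matrix.of fun i j => inner ℝ (![u, w] i) (![u', w'] j)) := by
    rw [snoc₂_eq_append, snoc₂_eq_append]
    ext i j
    rcases i with i | i <;> rcases j with j | j <;> simp
    fin_cases i
    · exact hu j
    · exact hw j
  rw [h, Matrix.det_fromBlocks_zero₂₁, Matrix.det_fin_two]
  simp

/-! ### The Hodge operator and its cube identity -/

/-- The endomorphism `w ↦ ⋆(c₁ ∧ ⋯ ∧ c_m ∧ w)` (up to sign), characterized by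
`⟪hodgeMap c w, u⟫ = det (c₁, …, c_m, u, w)`. -/
def hodgeMap (c : Fin m → RVec (m + 2)) : RVec (m + 2) →L[ℝ] RVec (m + 2) :=
  LinearMap.toContinuousLinearMap
    ((InnerProductSpace.toDual ℝ (RVec (m + 2))).symm.toLinearEquiv.toLinearMap ∘ₗ
      LinearMap.toContinuousLinearMap.toLinearMap ∘ₗ (volBilin c).flip)

lemma inner_hodgeMap_left (c : Fin m → RVec (m + 2)) (u w : RVec (m + 2)) :
    inner ℝ (hodgeMap c w) u = volBilin c u w := by
  simp [hodgeMap]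

lemma inner_hodgeMap_right (c : Fin m → RVec (m + 2)) (u w : RVec (m + 2)) :
    inner ℝ u (hodgeMap c w) = volBilin c u w := by
  rw [real_inner_comm, inner_hodgeMap_left]

lemma hodgeMap_skew (c : Fin m → RVec (m + 2)) (u w : RVec (m + 2)) :
    inner ℝ (hodgeMap c w) u = -inner ℝ w (hodgeMap c u) := by
  rw [inner_hodgeMap_left, inner_hodgeMap_right, volBilin_swap]

lemma inner_hodgeMap_mem (c : Fin m → RVec (m + 2)) (i : Fin m) (w : RVec (m + 2)) :
    inner ℝ (hodgeMap c w) (c i) = 0 := by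
  rw [inner_hodgeMap_left, volBilin_left_mem]

lemma hodgeMap_mem (c : Fin m → RVec (m + 2)) (i : Fin m) : hodgeMap c (c i) = 0 :=
  ext_inner_right ℝ fun u => by rw [inner_hodgeMap_left, volBilin_right_mem, inner_zero_left]

lemma inner_hodgeMap_self (c : Fin m → RVec (m + 2)) (w : RVec (m + 2)) :
    inner ℝ (hodgeMap c w) w = 0 := by
  rw [inner_hodgeMap_left, volBilin_self]

lemma hodgeMap_eq_zero_of_mem_span {c : Fin m → RVec (m + 2)} {w : RVec (m + 2)}
    (hw : w ∈ Submodule.span ℝ (Set.range c)) : hodgeMap c w = 0 := by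
  have h : Submodule.span ℝ (Set.range c) ≤ LinearMap.ker (hodgeMap c).toLinearMap := by
    rw [Submodule.span_le]
    rintro _ ⟨i, rfl⟩
    exact hodgeMap_mem c i
  exact h hw

/-- Multiplying by `volBilin c u w` turns the left side into a product covered by
`volBilin_mul_volBilin`, whose `2 × 2` factor is the square of `volBilin c u w`. If that number
vanishes it cannot be cancelled, but then `c, u, w` are dependent and the left side vanishes too. -/
lemma volBilin_hodgeMap_hodgeMap {c : Fin m → RVec (m + 2)} (hc : LinearIndependent ℝ c)
    (c' : Fin m → RVec (m + 2)) (u w : RVec (m + 2)) :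
    volBilin c' (hodgeMap c u) (hodgeMap c w) =
      Matrix.det (Matrix.of fun i j => inner ℝ (c' i) (c j)) * volBilin c u w := by
  by_cases hD : volBilin c u w = 0
  · rw [hD, mul_zero]
    by_cases hu : u ∈ Submodule.span ℝ (Set.range c)
    · simp [hodgeMap_eq_zero_of_mem_span hu]
    have hcu : LinearIndependent ℝ (Fin.snoc c u : Fin (m + 1) → _) :=
      linearIndependent_finSnoc.2 ⟨hc, hu⟩
    have hw : w ∈ Submodule.span ℝ (Set.range (Fin.snoc c u : Fin (m + 1) → _)) := by
      by_contra hw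
      exact volForm_ne_zero_iff.2 (linearIndependent_finSnoc.2 ⟨hcu, hw⟩) hD
    have h : Submodule.span ℝ (Set.range (Fin.snoc c u : Fin (m + 1) → _)) ≤
        LinearMap.ker (volBilin c' (hodgeMap c u) ∘ₗ (hodgeMap c).toLinearMap) := by
      rw [Submodule.span_le]
      rintro _ ⟨i, rfl⟩
      refine Fin.lastCases ?_ (fun i => ?_) i
      · simp [volBilin_self]
      · simp [hodgeMap_mem]
    exact h hw
  · refine mul_right_cancel₀ hD ?_
    rw [volBilin_mul_volBilin c' c _ _ u w (fun j => inner_hodgeMap_mem c j u)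
      (fun j => inner_hodgeMap_mem c j w), inner_hodgeMap_self, inner_hodgeMap_self,
      inner_hodgeMap_left, inner_hodgeMap_left, volBilin_swap c w u]
    ring

lemma hodgeMap_hodgeMap_hodgeMap {c : Fin m → RVec (m + 2)} (hc : LinearIndependent ℝ c)
    (c' : Fin m → RVec (m + 2)) (w : RVec (m + 2)) :
    hodgeMap c (hodgeMap c' (hodgeMap c w)) =
      -Matrix.det (Matrix.of fun i j => inner ℝ (c' i) (c j)) • hodgeMap c w := by
  refine ext_inner_right ℝ fun u => ?_
  rw [hodgeMap_skew, inner_hodgeMap_left, volBilin_hodgeMap_hodgeMap hc, inner_smul_left,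
    inner_hodgeMap_left]
  simp

/-- This is `det (A v₁, …, A v_n) = det A · det (v₁, …, v_n)` with the free slot moved across the
inner product by symmetry of `A`. -/
lemma map_hodgeMap_map {A : RVec (m + 2) →L[ℝ] RVec (m + 2)}
    (hA : ∀ u w, inner ℝ (A u) w = inner ℝ u (A w)) (c : Fin m → RVec (m + 2))
    (w : RVec (m + 2)) :
    A (hodgeMap (fun i => A (c i)) (A w)) = A.det • hodgeMap c w := by
  refine ext_inner_right ℝ fun u => ?_
  rw [hA, inner_hodgeMap_left, volBilin_map, inner_smul_left, inner_hodgeMap_left]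
  simp

lemma apply_inverse_of_det_ne_zero {E : Type*} [NormedAddCommGroup E] [NormedSpace ℝ E]
    [FiniteDimensional ℝ E] {A : E →L[ℝ] E} (hA : A.det ≠ 0) (v : E) : A (A.inverse v) = v := by
  have h : (A.toContinuousLinearEquivOfDetNeZero hA : E →L[ℝ] E) = A :=
    A.coe_toContinuousLinearEquivOfDetNeZero hA
  rw [← h, ContinuousLinearMap.inverse_equiv]
  exact ContinuousLinearEquiv.apply_symm_apply _ v

/-- The algebraic heart of the linearization at an equilibrium: the cube of `hodgeMap c ∘ A` is a
multiple of `hodgeMap c ∘ A`. -/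
lemma hodgeMap_comp_cube {A : RVec (m + 2) →L[ℝ] RVec (m + 2)}
    (hA : ∀ u w, inner ℝ (A u) w = inner ℝ u (A w)) (hdet : A.det ≠ 0)
    {c : Fin m → RVec (m + 2)} (hc : LinearIndependent ℝ c) (w : RVec (m + 2)) :
    hodgeMap c (A (hodgeMap c (A (hodgeMap c w)))) =
      -(A.det * Matrix.det (Matrix.of fun i j => inner ℝ (A.inverse (c i)) (c j))) •
        hodgeMap c w := by
  have h : c = fun i => A (A.inverse (c i)) := by
    ext1 i; rw [apply_inverse_of_det_ne_zero hdet]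
  -- Writing `c` as the image under `A` of `A.inverse ∘ c` absorbs both copies of `A` into one
  -- determinant and leaves a triple product of Hodge operators.
  have h2 : ∀ v, A (hodgeMap c (A v)) = A.det • hodgeMap (fun i => A.inverse (c i)) v := by
    intro v
    conv_lhs => rw [h]
    exact map_hodgeMap_map hA _ v
  rw [h2, map_smul, hodgeMap_hodgeMap_hodgeMap hc, smul_smul]
  congr 1
  ring

/-- The `m + 1` independent vectors `c, p` do not span a space of dimension `m + 2`; a vector
outside their span pairs nontrivially with `hodgeMap c p`. -/
lemma hodgeMap_ne_zero {c : Fin m → RVec (m + 2)} (hc : LinearIndependent ℝ c)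
    {p : RVec (m + 2)} (hp : p ∉ Submodule.span ℝ (Set.range c)) : hodgeMap c p ≠ 0 := by
  have hcp : LinearIndependent ℝ (Fin.snoc c p : Fin (m + 1) → _) :=
    linearIndependent_finSnoc.2 ⟨hc, hp⟩
  obtain ⟨u, hu⟩ : ∃ u, u ∉ Submodule.span ℝ (Set.range (Fin.snoc c p : Fin (m + 1) → _)) := by
    by_contra! h
    have h1 := finrank_range_le_card (R := ℝ) (Fin.snoc c p : Fin (m + 1) → RVec (m + 2))
    rw [Set.finrank, (Submodule.eq_top_iff').2 h, finrank_top] at h1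
    simp at h1
  have h : volBilin c p u ≠ 0 :=
    volForm_ne_zero_iff.2 (linearIndependent_finSnoc.2 ⟨hcp, hu⟩)
  intro h0
  rw [volBilin_swap, ← inner_hodgeMap_left, h0, inner_zero_left, neg_zero] at h
  exact h rfl

lemma exists_hodgeMap_ne_zero {c : Fin m → RVec (m + 2)} (hc : LinearIndependent ℝ c) :
    ∃ p, hodgeMap c p ≠ 0 := by
  obtain ⟨p, hp⟩ : ∃ p, p ∉ Submodule.span ℝ (Set.range c) := by
    by_contra! h
    have h1 := finrank_range_le_card (R := ℝ) c
    rw [Set.finrank, (Submodule.eq_top_iff').2 h, finrank_top] at h1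
    simp at h1
  exact ⟨p, hodgeMap_ne_zero hc hp⟩

lemma notMem_span_of_orthogonal {E : Type*} [NormedAddCommGroup E] [InnerProductSpace ℝ E]
    {c : Fin m → E} {p : E} (hp : ∀ i, inner ℝ p (c i) = 0) (hp0 : p ≠ 0) :
    p ∉ Submodule.span ℝ (Set.range c) := by
  intro h
  have h2 : Submodule.span ℝ (Set.range c) ≤ LinearMap.ker (innerₗ E p) := by
    rw [Submodule.span_le]
    rintro _ ⟨i, rfl⟩
    exact hp i
  exact hp0 (inner_self_eq_zero.1 (h2 h))

/-- If `det A · det [⟪A⁻¹ cᵢ, cⱼ⟫] > 0`, then the quadratic form of `A` is definite on the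
orthogonal complement of the vectors `cᵢ`. -/
lemma inner_map_self_ne_zero_of_pos {A : RVec (m + 2) →L[ℝ] RVec (m + 2)}
    (hA : ∀ u w, inner ℝ (A u) w = inner ℝ u (A w)) (hdet : A.det ≠ 0)
    {c : Fin m → RVec (m + 2)} (hc : LinearIndependent ℝ c)
    (hpos : 0 < A.det * Matrix.det (Matrix.of fun i j => inner ℝ (A.inverse (c i)) (c j)))
    {p : RVec (m + 2)} (hp : ∀ i, inner ℝ p (c i) = 0) (hp0 : p ≠ 0) :
    inner ℝ (A p) p ≠ 0 := by
  intro h0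
  -- Up to scale, `q` is `p` turned by a quarter in the plane orthogonal to `c`, so `p, q` is an
  -- orthogonal basis of that plane.
  set q := hodgeMap c p with hq
  have hqc : ∀ i, inner ℝ q (c i) = 0 := fun i => inner_hodgeMap_mem c i p
  have hpq : inner ℝ p q = 0 := by rw [hq, inner_hodgeMap_right, volBilin_self]
  have hqp : inner ℝ q p = 0 := by rw [real_inner_comm, hpq]
  have hq0 : q ≠ 0 := hodgeMap_ne_zero hc (notMem_span_of_orthogonal hp hp0)
  set c' := fun i => A.inverse (c i)
  have hAc' : (fun i => A (c' i)) = c := by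
    ext1 i; exact apply_inverse_of_det_ne_zero hdet (c i)
  have h1 := volBilin_mul_volBilin c' c p q p q hp hqc
  have hG : 0 < Matrix.det (Matrix.of fun i j => inner ℝ (c i) (c j)) :=
    (Matrix.posDef_gram_of_linearIndependent (𝕜 := ℝ) hc).det_pos
  -- The same product is computed twice: here as the Gram determinant of `c` times the `2 × 2`
  -- determinant of the form of `A` on `p, q`, and through `h6` and `h1` as a positive multiple of
  -- the quantity in `hpos`. An isotropic `p` would make the first value nonpositive.
  have h4 : volBilin c (A p) (A q) * volBilin c p q =
      Matrix.det (Matrix.of fun i j => inner ℝ (c i) (c j)) *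
        (inner ℝ (A p) p * inner ℝ (A q) q - inner ℝ (A p) q * inner ℝ (A q) p) := by
    have h5 : volBilin c p q * volBilin c (A p) (A q) = _ :=
      volBilin_mul_volBilin c c p q (A p) (A q) hp hqc
    rw [mul_comm, h5, real_inner_comm (A p) p, real_inner_comm (A q) q, real_inner_comm (A q) p,
      real_inner_comm (A p) q, mul_comm (inner ℝ (A q) p)]
  have h6 : volBilin c (A p) (A q) = A.det * volBilin c' p q := by
    rw [← volBilin_map, hAc']
  have h7 : inner ℝ (A q) p = inner ℝ (A p) q := by rw [hA, real_inner_comm]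
  rw [h6, mul_assoc, h1, h0, hpq, hqp, h7] at h4
  have hp2 : 0 < inner ℝ p p := real_inner_self_pos.2 hp0
  have hq2 : 0 < inner ℝ q q := real_inner_self_pos.2 hq0
  have h8 : 0 < A.det * Matrix.det (Matrix.of fun i j => inner ℝ (c' i) (c j)) *
      (inner ℝ p p * inner ℝ q q) := mul_pos hpos (mul_pos hp2 hq2)
  nlinarith [mul_nonneg hG.le (mul_self_nonneg (inner ℝ (A p) q))]

end

/-! ### Second-order expansion and isolation in level sets -/

section

open Filter Topology

variable {E : Type*} [NormedAddCommGroup E] [InnerProductSpace ℝ E]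

/-- Second order Taylor expansion of a function at a critical point. -/
lemma isLittleO_sub_half_inner [CompleteSpace E] {F : E → ℝ} {g : E → E} {A : E →L[ℝ] E} {x₀ : E}
    (hF : ∀ᶠ y in 𝓝 x₀, HasGradientAt F (g y) y) (h0 : g x₀ = 0) (hg : HasFDerivAt g A x₀)
    (hA : ∀ u w, inner ℝ (A u) w = inner ℝ u (A w)) :
    (fun x => F x - F x₀ - inner ℝ (A (x - x₀)) (x - x₀) / 2) =o[𝓝 x₀]
      fun x => ‖x - x₀‖ ^ 2 := by
  rw [Asymptotics.isLittleO_iff]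
  intro ε hε
  have h1 := (Asymptotics.isLittleO_iff.1 hg.isLittleO) hε
  obtain ⟨δ, hδ, hball⟩ := Metric.eventually_nhds_iff_ball.1 (h1.and hF)
  filter_upwards [Metric.ball_mem_nhds x₀ hδ] with x hx
  have hx' : ‖x - x₀‖ < δ := by rwa [← dist_eq_norm]
  have hq : ∀ y, HasFDerivAt (fun y => inner ℝ (A (y - x₀)) (y - x₀) / 2)
      (innerSL ℝ (A (y - x₀))) y := by
    intro y
    have h2 : HasFDerivAt (fun y => y - x₀) (ContinuousLinearMap.id ℝ E) y :=
      (hasFDerivAt_id y).sub_const x₀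
    have h3 := ((A.hasFDerivAt.comp y h2).inner ℝ h2).mul_const (1 / 2 : ℝ)
    convert! h3 using 1
    · ext y; simp [div_eq_mul_inv]
    · ext v
      have h4 : inner ℝ v (A (y - x₀)) = inner ℝ (A (y - x₀)) v := real_inner_comm _ _
      simp only [ContinuousLinearMap.comp_id, Function.comp_apply, _root_.smul_apply,
        ContinuousLinearMap.comp_apply, ContinuousLinearMap.prod_apply, fderivInnerCLM_apply,
        ContinuousLinearMap.id_apply, hA v, h4, innerSL_apply_apply, smul_eq_mul]
      ring
  -- Mean value inequality for `F` minus its quadratic part: on the ball of radius `‖x - x₀‖` the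
  -- gradient of the difference is at most `ε * ‖x - x₀‖`.
  have key := (convex_closedBall x₀ ‖x - x₀‖).norm_image_sub_le_of_norm_hasFDerivWithin_le
    (f := fun y => F y - inner ℝ (A (y - x₀)) (y - x₀) / 2)
    (f' := fun y => InnerProductSpace.toDual ℝ E (g y) - innerSL ℝ (A (y - x₀)))
    (C := ε * ‖x - x₀‖) (x := x₀) (y := x)
    (fun y hy => (((hball y ?_).2.hasFDerivAt).sub (hq y)).hasFDerivWithinAt)
    (fun y hy => ?_) (Metric.mem_closedBall_self (norm_nonneg _))
    (by rw [mem_closedBall_iff_norm])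
  · simp only [sub_self, map_zero, inner_zero_left, zero_div, sub_zero] at key
    rw [Real.norm_of_nonneg (by positivity : (0 : ℝ) ≤ ‖x - x₀‖ ^ 2)]
    convert! key using 1
    · congr 1; ring
    · ring
  · exact lt_of_le_of_lt (by simpa [dist_eq_norm] using hy) hx'
  · have hy' : ‖y - x₀‖ ≤ ‖x - x₀‖ := by simpa [dist_eq_norm] using hy
    have hy2 : y ∈ Metric.ball x₀ δ := by
      rw [mem_ball_iff_norm]; exact lt_of_le_of_lt hy' hx'
    have h4 := (hball y hy2).1
    rw [h0, sub_zero] at h4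
    have h5 : InnerProductSpace.toDual ℝ E (g y) - innerSL ℝ (A (y - x₀)) =
        InnerProductSpace.toDual ℝ E (g y - A (y - x₀)) := by
      ext; simp
    rw [h5, LinearIsometryEquiv.norm_map]
    exact h4.trans (by gcongr)

/-- A critical point of `F` at which the Hessian has no isotropic vector in the common kernel of
the differentials of the functions `Cᵢ` is isolated in the common level set of `F` and `C`. -/
lemma eventually_eq_of_mem_levelSet [FiniteDimensional ℝ E] {ι : Type*} [Fintype ι] {F : E → ℝ}
    {g : E → E} {A : E →L[ℝ] E} {x₀ : E} {C : ι → E → ℝ} {c : ι → E}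
    (hF : ∀ᶠ y in 𝓝 x₀, HasGradientAt F (g y) y) (h0 : g x₀ = 0) (hg : HasFDerivAt g A x₀)
    (hA : ∀ u w, inner ℝ (A u) w = inner ℝ u (A w))
    (hC : ∀ i, HasGradientAt (C i) (c i) x₀)
    (hdef : ∀ p, (∀ i, inner ℝ p (c i) = 0) → p ≠ 0 → inner ℝ (A p) p ≠ 0) :
    ∀ᶠ x in 𝓝 x₀, F x = F x₀ → (∀ i, C i x = C i x₀) → x = x₀ := by
  have : ProperSpace E := FiniteDimensional.proper ℝ E
  -- Definiteness on the common kernel, made quantitative by compactness of the unit sphere: no unit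
  -- direction is almost isotropic and almost tangent to all the level sets at once.
  obtain ⟨a, ha, hmin⟩ : ∃ a > 0, ∀ u : E, ‖u‖ = 1 →
      a ≤ |inner ℝ (A u) u| + ∑ i, |inner ℝ (c i) u| := by
    rcases (Metric.sphere (0 : E) 1).eq_empty_or_nonempty with he | hne
    · refine ⟨1, one_pos, fun u hu => ?_⟩
      have : u ∈ Metric.sphere (0 : E) 1 := by simpa using hu
      simp [he] at this
    · obtain ⟨u₀, hu₀, hu₀'⟩ := (isCompact_sphere (0 : E) 1).exists_isMinOn hne
        (f := fun u => |inner ℝ (A u) u| + ∑ i, |inner ℝ (c i) u|)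
        (Continuous.continuousOn (by fun_prop))
      refine ⟨_, ?_, fun u hu => hu₀' (by simpa using hu)⟩
      have hs : 0 ≤ ∑ i, |inner ℝ (c i) u₀| := Finset.sum_nonneg fun i _ => abs_nonneg _
      refine lt_of_le_of_ne (by positivity) fun h => ?_
      have h1 : |inner ℝ (A u₀) u₀| = 0 := by linarith [abs_nonneg (inner ℝ (A u₀) u₀)]
      have h2 : ∑ i, |inner ℝ (c i) u₀| = 0 := by linarith [abs_nonneg (inner ℝ (A u₀) u₀)]
      refine hdef u₀ (fun i => ?_) (fun h => ?_) (abs_eq_zero.1 h1)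
      · rw [real_inner_comm]
        exact abs_eq_zero.1 ((Finset.sum_eq_zero_iff_of_nonneg fun i _ => abs_nonneg _).1 h2 i
          (Finset.mem_univ i))
      · simp [h] at hu₀
  -- On the normalized displacement, the quadratic term is at most `2ε` and each linear term at most
  -- `ε`. The total `(card ι + 2) ε = a / 2` falls below the lower bound `a`.
  set ε := a / (2 * (Fintype.card ι + 2)) with hε
  have hε0 : 0 < ε := by positivity
  have h1 := (Asymptotics.isLittleO_iff.1 (isLittleO_sub_half_inner hF h0 hg hA)) hε0
  have h2 : ∀ᶠ x in 𝓝 x₀, ∀ i, ‖C i x - C i x₀ - InnerProductSpace.toDual ℝ E (c i) (x - x₀)‖ ≤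
      ε * ‖x - x₀‖ :=
    eventually_all.2 fun i => (Asymptotics.isLittleO_iff.1 (hC i).hasFDerivAt.isLittleO) hε0
  filter_upwards [h1, h2] with x hx1 hx2 hFx hCx
  by_contra hne
  set z := x - x₀
  have hz : 0 < ‖z‖ := norm_pos_iff.2 (sub_ne_zero.2 hne)
  have hq : |inner ℝ (A z) z| ≤ 2 * ε * ‖z‖ ^ 2 := by
    rw [hFx, sub_self, zero_sub, norm_neg, Real.norm_eq_abs, abs_div, abs_two,
      Real.norm_of_nonneg (by positivity)] at hx1
    linarith
  have hl : ∀ i, |inner ℝ (c i) z| ≤ ε * ‖z‖ := by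
    intro i
    have := hx2 i
    rwa [hCx i, sub_self, zero_sub, norm_neg, Real.norm_eq_abs,
      InnerProductSpace.toDual_apply_apply] at this
  have hu := hmin (‖z‖⁻¹ • z) (by rw [norm_smul, norm_inv, norm_norm, inv_mul_cancel₀ hz.ne'])
  have e1 : |inner ℝ (A (‖z‖⁻¹ • z)) (‖z‖⁻¹ • z)| ≤ 2 * ε := by
    rw [map_smul, inner_smul_left, inner_smul_right, abs_mul, abs_mul]
    simp only [map_inv₀, RCLike.conj_to_real, abs_inv, abs_norm]
    calc ‖z‖⁻¹ * (‖z‖⁻¹ * |inner ℝ (A z) z|) ≤ ‖z‖⁻¹ * (‖z‖⁻¹ * (2 * ε * ‖z‖ ^ 2)) := by gcongr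
      _ = 2 * ε := by field_simp
  have e2 : ∑ i, |inner ℝ (c i) (‖z‖⁻¹ • z)| ≤ Fintype.card ι * ε := by
    have : ∀ i ∈ Finset.univ, |inner ℝ (c i) (‖z‖⁻¹ • z)| ≤ ε := by
      intro i _
      rw [inner_smul_right, abs_mul, abs_inv, abs_norm]
      calc ‖z‖⁻¹ * |inner ℝ (c i) z| ≤ ‖z‖⁻¹ * (ε * ‖z‖) := by gcongr; exact hl i
        _ = ε := by field_simp
    simpa using Finset.sum_le_card_nsmul _ _ _ this
  have e3 : (Fintype.card ι + 2) * ε = a / 2 := by rw [hε]; field_simp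
  linarith

/-! ### Instability from a positive eigenvalue -/

/-- The spectral projections of an operator satisfying `B³ = σ² B`. -/
lemma exists_spectral_splitting {B : E →L[ℝ] E} {σ : ℝ} (hσ : σ ≠ 0)
    (hB : ∀ v, B (B (B v)) = σ ^ 2 • B v) (hB0 : ∃ v, B (B v) + σ • B v ≠ 0) :
    ∃ P Q R : E →L[ℝ] E, (∀ v, P (B v) = σ • P v) ∧ (∀ v, Q (B v) = -σ • Q v) ∧
      (∀ v, R (B v) = 0) ∧ (∀ v, v = P v + Q v + R v) ∧
      ∃ e ≠ 0, P e = e ∧ Q e = 0 ∧ R e = 0 := by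
  -- Lagrange interpolation at the roots `σ`, `-σ`, `0` of `t³ - σ² t`. The hypothesis `hB0` says
  -- that `P` is nonzero.
  set P : E →L[ℝ] E := (2 * σ ^ 2)⁻¹ • (B ∘L B + σ • B) with hP
  set Q : E →L[ℝ] E := (2 * σ ^ 2)⁻¹ • (B ∘L B - σ • B) with hQ
  set R : E →L[ℝ] E := ContinuousLinearMap.id ℝ _ - (σ ^ 2)⁻¹ • (B ∘L B) with hR
  have hPB : ∀ v, P (B v) = σ • P v := by
    intro v
    simp only [hP, _root_.smul_apply, _root_.add_apply,
      ContinuousLinearMap.comp_apply, hB]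
    module
  have hQB : ∀ v, Q (B v) = -σ • Q v := by
    intro v
    simp only [hQ, _root_.smul_apply, _root_.sub_apply,
      ContinuousLinearMap.comp_apply, hB]
    module
  have hRB : ∀ v, R (B v) = 0 := by
    intro v
    simp only [hR, _root_.smul_apply, _root_.sub_apply,
      ContinuousLinearMap.comp_apply, hB, ContinuousLinearMap.id_apply, smul_smul,
      inv_mul_cancel₀ (pow_ne_zero 2 hσ), one_smul, sub_self]
  have hsum : ∀ v, v = P v + Q v + R v := by
    intro v
    simp only [hP, hQ, hR, _root_.smul_apply, _root_.sub_apply,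
      _root_.add_apply, ContinuousLinearMap.comp_apply, ContinuousLinearMap.id_apply]
    match_scalars <;> field_simp <;> ring
  obtain ⟨v, hv⟩ := hB0
  refine ⟨P, Q, R, hPB, hQB, hRB, hsum, B (B v) + σ • B v, hv, ?_⟩
  generalize he : B (B v) + σ • B v = e
  have hBe : B e = σ • e := by simp only [← he, map_add, map_smul, hB]; module
  refine ⟨?_, ?_, ?_⟩
  · simp only [hP, _root_.smul_apply, _root_.add_apply, ContinuousLinearMap.comp_apply, hBe,
      map_smul]
    match_scalars
    field_simp
    ring
  · simp only [hQ, _root_.smul_apply, _root_.sub_apply, ContinuousLinearMap.comp_apply, hBe,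
      map_smul]
    module
  · simp only [hR, _root_.sub_apply, _root_.smul_apply, ContinuousLinearMap.comp_apply, hBe,
      map_smul, ContinuousLinearMap.id_apply]
    match_scalars
    field_simp
    ring

/-- A function satisfying `f' ≥ σ f` wherever it is nonnegative, with `f 0 > 0`, is unbounded. -/
lemma exists_lt_of_mul_le_deriv {f f' : ℝ → ℝ} {σ : ℝ} (hσ : 0 < σ) (hf0 : 0 < f 0)
    (hfc : ContinuousOn f (Set.Ici 0))
    (hf' : ∀ t, 0 ≤ t → HasDerivWithinAt f (f' t) (Set.Ici t) t)
    (hgrow : ∀ t, 0 ≤ t → 0 ≤ f t → σ * f t ≤ f' t) (M : ℝ) : ∃ t, 0 ≤ t ∧ M < f t := by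
  -- The barrier is the line from `f 0` with half the initial growth rate: at a contact time `f ≥ f
  -- 0`, so `f' ≥ σ * f 0` exceeds the slope strictly, as the comparison theorem requires.
  have hpos : 0 < σ * f 0 / 2 := by positivity
  have hlow : ∀ T, 0 ≤ T → f 0 + σ * f 0 / 2 * T ≤ f T := by
    intro T hT
    have hB : ∀ t, HasDerivAt (fun t => -(f 0 + σ * f 0 / 2 * t)) (-(σ * f 0 / 2)) t := by
      intro t
      simpa only [mul_one, id] using!
        (((hasDerivAt_id t).const_mul (σ * f 0 / 2)).const_add (f 0)).neg
    have := image_le_of_deriv_right_lt_deriv_boundary' (f := fun t => -f t)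
      (f' := fun t => -f' t) (a := 0) (b := T)
      (B := fun t => -(f 0 + σ * f 0 / 2 * t)) (B' := fun _ => -(σ * f 0 / 2))
      (hfc.mono Set.Icc_subset_Ici_self).neg (fun t ht => (hf' t ht.1).neg) (by simp)
      (by fun_prop) (fun t _ => (hB t).hasDerivWithinAt)
      (fun t ht heq => by
        have h2 : f t = f 0 + σ * f 0 / 2 * t := neg_injective heq
        have h3 : f 0 ≤ f t := by
          rw [h2]
          have := mul_nonneg hpos.le ht.1
          linarith
        have h4 := hgrow t ht.1 (hf0.le.trans h3)
        have h5 : σ * f 0 ≤ σ * f t := by gcongr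
        linarith)
      (Set.right_mem_Icc.2 hT)
    exact neg_le_neg_iff.1 this
  have hT : 0 ≤ |M| / (σ * f 0 / 2) := by positivity
  refine ⟨_, hT, ?_⟩
  have h2 := hlow _ hT
  rw [mul_div_cancel₀ _ hpos.ne'] at h2
  linarith [le_abs_self M]

/-- The spectral hypothesis under which the linearization at an equilibrium forces instability. -/
theorem not_isLyapunovStable_of_cube_eq {k : ℕ} {Ω : Set (RVec k)} {X : RVec k → RVec k}
    {x₀ : RVec k} {B : RVec k →L[ℝ] RVec k} {σ : ℝ} (hΩ : IsOpen Ω) (hx₀ : x₀ ∈ Ω)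
    (hX0 : X x₀ = 0) (hX : HasFDerivAt X B x₀) (hσ : 0 < σ)
    (hB : ∀ v, B (B (B v)) = σ ^ 2 • B v) (hB0 : ∃ v, B (B v) + σ • B v ≠ 0) :
    ¬ IsLyapunovStable Ω X x₀ := by
  rintro ⟨-, hstab⟩
  obtain ⟨P, Q, R, hPB, hQB, hRB, hsum, e, he, hPe, hQe, hRe⟩ :=
    exists_spectral_splitting hσ.ne' hB hB0
  -- Chetaev function: on the cone `V ≥ 0` the unstable component `P v` controls all of `v`.
  set V : RVec k → ℝ := fun v => ‖P v‖ ^ 2 - ‖Q v‖ ^ 2 - ‖R v‖ ^ 2 with hV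
  have hnorm : ∀ v, 0 ≤ V v → ‖v‖ ≤ 3 * ‖P v‖ := by
    intro v hv
    have h1 : ‖v‖ ≤ ‖P v‖ + ‖Q v‖ + ‖R v‖ := by
      conv_lhs => rw [hsum v]
      exact norm_add₃_le
    have h2 : ‖Q v‖ ≤ ‖P v‖ := by
      refine le_of_sq_le_sq ?_ (norm_nonneg _)
      simp only [hV] at hv
      nlinarith [sq_nonneg ‖R v‖]
    have h3 : ‖R v‖ ≤ ‖P v‖ := by
      refine le_of_sq_le_sq ?_ (norm_nonneg _)
      simp only [hV] at hv
      nlinarith [sq_nonneg ‖Q v‖]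
    linarith
  set K := ‖P‖ ^ 2 + ‖Q‖ ^ 2 + ‖R‖ ^ 2 with hK
  have hK0 : 0 ≤ K := by positivity
  -- the derivative of `V` along the vector field
  set V' : RVec k → RVec k → ℝ := fun v w =>
    2 * inner ℝ (P v) (P w) - 2 * inner ℝ (Q v) (Q w) - 2 * inner ℝ (R v) (R w) with hV'
  have hVB : ∀ v, V' v (B v) = 2 * σ * ‖P v‖ ^ 2 + 2 * σ * ‖Q v‖ ^ 2 := by
    intro v
    simp only [hV', hPB, hQB, hRB, inner_smul_right, inner_zero_right,
      real_inner_self_eq_norm_sq]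
    ring
  have hVr : ∀ v r, -(2 * K * (‖v‖ * ‖r‖)) ≤ V' v r := by
    intro v r
    have hb : ∀ T : RVec k →L[ℝ] RVec k, |inner ℝ (T v) (T r)| ≤ ‖T‖ ^ 2 * (‖v‖ * ‖r‖) := by
      intro T
      calc |inner ℝ (T v) (T r)| ≤ ‖T v‖ * ‖T r‖ := abs_real_inner_le_norm _ _
        _ ≤ (‖T‖ * ‖v‖) * (‖T‖ * ‖r‖) := by gcongr <;> exact T.le_opNorm _
        _ = _ := by ring
    have h1 := neg_le_of_abs_le (hb P)
    have h2 := le_of_abs_le (hb Q)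
    have h3 := le_of_abs_le (hb R)
    simp only [hV', hK]
    linarith
  -- The factor `18 = 2 * 3²` combines the bound `2K` on `V'` with the cone estimate `‖v‖ ≤ 3 * ‖P
  -- v‖`. The remainder then costs at most `σ * ‖P v‖²`, half of the linear growth `2 * σ * ‖P v‖²`.
  -- The `+ 1` keeps the denominator positive.
  set ε := σ / (18 * K + 1) with hε
  have hε0 : 0 < ε := by positivity
  have hKε : 18 * K * ε ≤ σ := by
    rw [hε, ← mul_div_assoc, div_le_iff₀ (by positivity)]
    nlinarith
  have h1 := (Asymptotics.isLittleO_iff.1 hX.isLittleO) hε0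
  obtain ⟨δ, hδ, hball⟩ := Metric.eventually_nhds_iff_ball.1 h1
  have hgrow : ∀ y ∈ Metric.ball x₀ δ, 0 ≤ V (y - x₀) → σ * V (y - x₀) ≤ V' (y - x₀) (X y) := by
    intro y hy hVy
    have hr := hball y hy
    rw [hX0, sub_zero] at hr
    set z := y - x₀
    have h2 : V' z (X y) = V' z (B z) + V' z (X y - B z) := by
      simp only [hV', map_sub, inner_sub_right]
      ring
    have h3 := hVr z (X y - B z)
    have h4 : ‖z‖ * ‖X y - B z‖ ≤ ε * (9 * ‖P z‖ ^ 2) := by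
      have h5 := hnorm z hVy
      calc ‖z‖ * ‖X y - B z‖ ≤ ‖z‖ * (ε * ‖z‖) := by gcongr
        _ = ε * ‖z‖ ^ 2 := by ring
        _ ≤ ε * (3 * ‖P z‖) ^ 2 := by gcongr
        _ = _ := by ring
    have h6 : 2 * K * (‖z‖ * ‖X y - B z‖) ≤ σ * ‖P z‖ ^ 2 := by
      calc 2 * K * (‖z‖ * ‖X y - B z‖) ≤ 2 * K * (ε * (9 * ‖P z‖ ^ 2)) := by gcongr
        _ = 18 * K * ε * ‖P z‖ ^ 2 := by ring
        _ ≤ _ := by gcongr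
    rw [h2, hVB]
    have h7 : σ * V z ≤ σ * ‖P z‖ ^ 2 := by
      gcongr
      simp only [hV]
      nlinarith [sq_nonneg ‖Q z‖, sq_nonneg ‖R z‖]
    nlinarith [mul_nonneg hσ.le (sq_nonneg ‖Q z‖)]
  obtain ⟨W, hWo, -, hxW, hW⟩ := hstab (Ω ∩ Metric.ball x₀ δ) (hΩ.inter Metric.isOpen_ball)
    Set.inter_subset_left ⟨hx₀, Metric.mem_ball_self hδ⟩
  -- Start arbitrarily close to `x₀` along the eigenvector `e`, where `V` is positive.
  obtain ⟨s, hsW, hs⟩ : ∃ s : ℝ, x₀ + s • e ∈ W ∧ 0 < s := by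
    have hc : Continuous fun s : ℝ => x₀ + s • e := by fun_prop
    have h2 : ∀ᶠ s in 𝓝 (0 : ℝ), x₀ + s • e ∈ W :=
      hc.continuousAt.eventually_mem (hWo.mem_nhds (by simpa using hxW))
    have h3 : ∀ᶠ s in 𝓝[>] (0 : ℝ), x₀ + s • e ∈ W := h2.filter_mono nhdsWithin_le_nhds
    exact (h3.and self_mem_nhdsWithin).exists
  obtain ⟨γ, hγ0, hγ, hγU⟩ := hW _ hsW
  set f : ℝ → ℝ := fun t => V (γ t - x₀) with hf
  have hf0 : 0 < f 0 := by
    simp only [hf, hγ0, add_sub_cancel_left, hV, map_smul, hPe, hQe, hRe, smul_zero, norm_zero]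
    have := norm_pos_iff.2 (smul_ne_zero hs.ne' he)
    simpa using pow_pos this 2
  have hf' : ∀ t, 0 ≤ t → HasDerivWithinAt f (V' (γ t - x₀) (X (γ t))) (Set.Ici t) t := by
    intro t ht
    have h2 : HasDerivWithinAt (fun t => γ t - x₀) (X (γ t)) (Set.Ici t) t :=
      ((hγ t ht).mono (Set.Ici_subset_Ici.2 ht)).sub_const x₀
    have h3 : ∀ T : RVec k →L[ℝ] RVec k, HasDerivWithinAt (fun t => ‖T (γ t - x₀)‖ ^ 2)
        (2 * inner ℝ (T (γ t - x₀)) (T (X (γ t)))) (Set.Ici t) t := fun T =>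
      (T.hasFDerivAt.comp_hasDerivWithinAt t h2).norm_sq
    exact ((h3 P).sub (h3 Q)).sub (h3 R)
  have hfc : ContinuousOn f (Set.Ici 0) := by
    have h2 : ContinuousOn γ (Set.Ici 0) := hγ.continuousOn
    simp only [hf, hV]
    fun_prop
  obtain ⟨T, hT, hlt⟩ := exists_lt_of_mul_le_deriv hσ hf0 hfc hf'
    (fun t ht hft => hgrow (γ t) (hγU t ht).2 hft) ((‖P‖ * δ) ^ 2)
  have h2 : ‖γ T - x₀‖ < δ := mem_ball_iff_norm.1 (hγU T hT).2
  have h3 : ‖P (γ T - x₀)‖ ≤ ‖P‖ * δ := (P.le_opNorm _).trans (by gcongr)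
  have h4 : ‖P (γ T - x₀)‖ ^ 2 ≤ (‖P‖ * δ) ^ 2 := by gcongr
  simp only [hf, hV] at hlt
  linarith [sq_nonneg ‖Q (γ T - x₀)‖, sq_nonneg ‖R (γ T - x₀)‖]

end

/-! ### Global integral curves and Lyapunov's direct method -/

section

open Filter Topology
open scoped NNReal

/-- A bounded Lipschitz vector field has forward integral curves defined for all times. -/
lemma exists_isIntegralCurveOn_Ici {E : Type*} [NormedAddCommGroup E] [NormedSpace ℝ E]
    [CompleteSpace E] {Y : E → E} {K L : ℝ≥0} (hK : LipschitzWith K Y) (hL : ∀ x, ‖Y x‖ ≤ L)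
    (y : E) : ∃ γ : ℝ → E, γ 0 = y ∧ IsIntegralCurveOn γ (fun _ => Y) (Set.Ici 0) := by
  have hex : ∀ n : ℕ, ∃ α : ℝ → E, α 0 = y ∧
      ∀ t ∈ Set.Icc (0 : ℝ) n, HasDerivWithinAt α (Y (α t)) (Set.Icc 0 n) t := by
    intro n
    -- The bound `L` on the speed makes the radius `L * n` sufficient for the whole interval `[0,
    -- n]`.
    have hPL : IsPicardLindelof (fun _ => Y) (tmin := 0) (tmax := n)
        ⟨0, Set.left_mem_Icc.2 n.cast_nonneg⟩ y (L * n) 0 L K :=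
      IsPicardLindelof.of_time_independent (fun x _ => hL x) hK.lipschitzOnWith (by simp)
    exact hPL.exists_eq_forall_mem_Icc_hasDerivWithinAt₀
  choose α hα0 hα using hex
  have hcont : ∀ n, ContinuousOn (α n) (Set.Icc 0 n) := fun n t ht =>
    (hα n t ht).continuousWithinAt
  have huniq : ∀ n k : ℕ, n ≤ k → Set.EqOn (α n) (α k) (Set.Icc 0 n) := by
    intro n k hnk
    have hnk' : (n : ℝ) ≤ k := by exact_mod_cast hnk
    have hd : ∀ j : ℕ, (n : ℝ) ≤ j → ∀ t ∈ Set.Ico (0 : ℝ) n,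
        HasDerivWithinAt (α j) (Y (α j t)) (Set.Ici t) t := by
      intro j hj t ht
      have h1 := (hα j t ⟨ht.1, ht.2.le.trans hj⟩).mono
        (Set.Icc_subset_Icc_left (b := (j : ℝ)) ht.1)
      exact h1.mono_of_mem_nhdsWithin (Icc_mem_nhdsGE (ht.2.trans_le hj))
    exact ODE_solution_unique_of_mem_Icc_right (v := fun _ => Y) (s := fun _ => Set.univ) (K := K)
      (fun _ _ => hK.lipschitzOnWith) (hcont n) (hd n le_rfl) (fun _ _ => trivial)
      ((hcont k).mono (Set.Icc_subset_Icc_right hnk')) (hd k hnk') (fun _ _ => trivial)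
      (by rw [hα0, hα0])
  -- By uniqueness the solutions on the intervals `[0, n]` agree, so evaluating the one with index
  -- `⌈t⌉₊` glues them.
  set γ : ℝ → E := fun t => α ⌈t⌉₊ t with hγ
  have hγα : ∀ (n : ℕ), Set.EqOn γ (α n) (Set.Icc 0 n) := by
    intro n t ht
    exact huniq _ _ (Nat.ceil_le.2 ht.2) ⟨ht.1, Nat.le_ceil t⟩
  refine ⟨γ, by simp [hγ, hα0], fun t ht => ?_⟩
  obtain ⟨n, hn⟩ := exists_nat_gt t
  have htn : t ∈ Set.Icc (0 : ℝ) n := ⟨ht, hn.le⟩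
  have h1 : HasDerivWithinAt γ (Y (γ t)) (Set.Icc 0 n) t := by
    rw [hγα n htn]
    exact (hα n t htn).congr (hγα n) (hγα n htn)
  refine h1.mono_of_mem_nhdsWithin ?_
  filter_upwards [self_mem_nhdsWithin, nhdsWithin_le_nhds (Iio_mem_nhds hn)] with s hs hsn
  exact ⟨hs, le_of_lt hsn⟩

/-- **Lyapunov's direct method** for an equilibrium which is an isolated zero of a nonnegative
first integral. -/
theorem isLyapunovStable_of_firstIntegral {k : ℕ} {Ω : Set (RVec k)} {X : RVec k → RVec k}
    {x₀ : RVec k} {G : RVec k → ℝ} (hΩ : IsOpen Ω) (hx₀ : x₀ ∈ Ω) (hX0 : X x₀ = 0)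
    (hX : ContDiffOn ℝ 1 X Ω) (hG : DifferentiableOn ℝ G Ω)
    (hGX : ∀ x ∈ Ω, fderiv ℝ G x (X x) = 0) (hG0 : G x₀ = 0) (hGnn : ∀ x, 0 ≤ G x)
    (hiso : ∀ᶠ x in 𝓝 x₀, G x = 0 → x = x₀) : IsLyapunovStable Ω X x₀ := by
  refine ⟨hX0, fun U hU hUΩ hxU => ?_⟩
  obtain ⟨R, hR, hRU⟩ := Metric.nhds_basis_closedBall.mem_iff.1
    (inter_mem (hU.mem_nhds hxU) hiso)
  set r := R / 2 with hr
  have hr0 : 0 < r := by positivity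
  have hrR : r < R := by linarith
  have hRΩ : Metric.closedBall x₀ R ⊆ Ω := fun x hx => hUΩ (hRU hx).1
  -- the truncated vector field
  let χ : ContDiffBump x₀ := ⟨r, R, hr0, hrR⟩
  set Y : RVec k → RVec k := fun x => χ x • X x with hY
  have hYsupp : ∀ x, x ∉ Metric.closedBall x₀ R → χ =ᶠ[𝓝 x] 0 := by
    intro x hx
    rw [← notMem_tsupport_iff_eventuallyEq, χ.tsupport_eq]
    exact hx
  have hYc : HasCompactSupport Y := χ.hasCompactSupport.smul_right
  have hYd : ContDiff ℝ 1 Y := by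
    rw [contDiff_iff_contDiffAt]
    intro x
    by_cases hx : x ∈ Metric.closedBall x₀ R
    · exact χ.contDiff.contDiffAt.smul (hX.contDiffAt (hΩ.mem_nhds (hRΩ hx)))
    · have : Y =ᶠ[𝓝 x] fun _ => 0 := by
        filter_upwards [hYsupp x hx] with z hz
        simp [hY, hz]
      exact contDiffAt_const.congr_of_eventuallyEq this
  obtain ⟨K, hK⟩ := ContDiff.lipschitzWith_of_hasCompactSupport hYc hYd one_ne_zero
  obtain ⟨L, hL⟩ := hYc.exists_bound_of_continuous hYd.continuous
  have hL0 : 0 ≤ L := (norm_nonneg _).trans (hL x₀)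
  -- the minimum of `G` on the sphere
  have hrΩ : Metric.closedBall x₀ r ⊆ Ω := (Metric.closedBall_subset_closedBall hrR.le).trans hRΩ
  obtain ⟨η, hη, hηG⟩ : ∃ η > 0, ∀ x ∈ Metric.sphere x₀ r, η ≤ G x := by
    rcases (Metric.sphere x₀ r).eq_empty_or_nonempty with he | hne
    · exact ⟨1, one_pos, fun x hx => by simp [he] at hx⟩
    · obtain ⟨u, hu, hmin⟩ := (isCompact_sphere x₀ r).exists_isMinOn hne
        (hG.continuousOn.mono (Metric.sphere_subset_closedBall.trans hrΩ))
      refine ⟨G u, (hGnn u).lt_of_ne fun h => ?_, fun x hx => hmin hx⟩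
      have hur : u = x₀ := (hRU (Metric.closedBall_subset_closedBall hrR.le
        (Metric.sphere_subset_closedBall hu))).2 h.symm
      rw [hur, Metric.mem_sphere, dist_self] at hu
      exact hr0.ne hu
  have hGc : ContinuousAt G x₀ := (hG.differentiableAt (hΩ.mem_nhds hx₀)).continuousAt
  have hWn : {x | x ∈ Metric.ball x₀ r ∧ G x < η} ∈ 𝓝 x₀ :=
    inter_mem (Metric.ball_mem_nhds x₀ hr0)
      (hGc.eventually_lt continuousAt_const (by rwa [hG0]))
  refine ⟨interior {x | x ∈ Metric.ball x₀ r ∧ G x < η}, isOpen_interior, fun x hx => ?_,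
    mem_interior_iff_mem_nhds.2 hWn, fun y hy => ?_⟩
  · exact (hRU (Metric.closedBall_subset_closedBall hrR.le
      (Metric.ball_subset_closedBall (interior_subset hx).1))).1
  obtain ⟨hyr, hyη⟩ := interior_subset hy
  obtain ⟨γ, hγ0, hγ⟩ := exists_isIntegralCurveOn_Ici hK (L := L.toNNReal)
    (fun x => by rw [Real.coe_toNNReal _ hL0]; exact hL x) y
  have hγc : ContinuousOn γ (Set.Ici 0) := hγ.continuousOn
  have hstay : ∀ t, 0 ≤ t → γ t ∈ Metric.ball x₀ r := by
    intro T hT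
    by_contra hout
    have hout' : r ≤ dist (γ T) x₀ := by simpa using hout
    have hdc : ContinuousOn (fun t => dist (γ t) x₀) (Set.Ici 0) :=
      (continuous_id.dist continuous_const : Continuous fun x => dist x x₀).comp_continuousOn hγc
    have hd0 : dist (γ 0) x₀ < r := by rw [hγ0]; exact hyr
    -- The least element of this compact set is the first time on the sphere. Up to it `G` is
    -- conserved, since the truncated field is a pointwise multiple of `X`; but `G < η` initially
    -- and `G ≥ η` on the sphere.
    set S := Set.Icc 0 T ∩ (fun t => dist (γ t) x₀) ⁻¹' {r} with hS
    have hSc : IsCompact S := isCompact_Icc.of_isClosed_subset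
      ((hdc.mono Set.Icc_subset_Ici_self).preimage_isClosed_of_isClosed isClosed_Icc
        isClosed_singleton) Set.inter_subset_left
    have hivt : ∀ b, 0 ≤ b → r ≤ dist (γ b) x₀ → ∃ s ∈ Set.Icc 0 b, dist (γ s) x₀ = r :=
      fun b hb hbr => intermediate_value_Icc hb (hdc.mono Set.Icc_subset_Ici_self) ⟨hd0.le, hbr⟩
    obtain ⟨s₁, hs₁, hs₁r⟩ := hivt T hT hout'
    obtain ⟨s, ⟨hsT, hsr⟩, hsmin⟩ := hSc.exists_isLeast ⟨s₁, hs₁, hs₁r⟩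
    have hin : ∀ t ∈ Set.Icc 0 s, γ t ∈ Metric.closedBall x₀ r := by
      intro t ht
      by_contra htr
      have htr' : r < dist (γ t) x₀ := by simpa using htr
      obtain ⟨u, hu, hur⟩ := hivt t ht.1 htr'.le
      have hsu : s ≤ u := hsmin ⟨⟨hu.1, hu.2.trans (ht.2.trans hsT.2)⟩, hur⟩
      have hut : u = t := le_antisymm hu.2 (ht.2.trans hsu)
      rw [hut] at hur
      exact htr'.ne' hur
    have hGconst : ∀ t ∈ Set.Icc 0 s, G (γ t) = G (γ 0) := by
      refine constant_of_has_deriv_right_zero ?_ fun t ht => ?_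
      · exact hG.continuousOn.comp (hγc.mono Set.Icc_subset_Ici_self) fun t ht => hrΩ (hin t ht)
      · have htΩ : γ t ∈ Ω := hrΩ (hin t (Set.Ico_subset_Icc_self ht))
        have h1 : HasDerivWithinAt γ (Y (γ t)) (Set.Ici t) t :=
          (hγ t ht.1).mono (Set.Ici_subset_Ici.2 ht.1)
        have h2 := (hG.differentiableAt (hΩ.mem_nhds htΩ)).hasFDerivAt.comp_hasDerivWithinAt t h1
        simpa only [hY, map_smul, hGX _ htΩ, smul_zero] using! h2
    have h3 := hGconst s (Set.right_mem_Icc.2 hsT.1)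
    rw [hγ0] at h3
    have h4 := hηG (γ s) hsr
    linarith
  refine ⟨γ, hγ0, fun t ht => ?_, fun t ht => ?_⟩
  · have h1 : HasDerivWithinAt γ (Y (γ t)) (Set.Ici 0) t := hγ t ht
    have h2 : Y (γ t) = X (γ t) := by
      simp only [hY]
      rw [χ.one_of_mem_closedBall (Metric.ball_subset_closedBall (hstay t ht)), one_smul]
    rwa [h2] at h1
  · exact (hRU (Metric.closedBall_subset_closedBall hrR.le
      (Metric.ball_subset_closedBall (hstay t ht)))).1

end

/-! ### Gradients, Hessians and wedge products -/

section

open Filter Topology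

variable {k : ℕ}

lemma gradient_apply_eq_fderiv (f : RVec k → ℝ) (x : RVec k) (j : Fin k) :
    ∇ f x j = fderiv ℝ f x (EuclideanSpace.single j 1) := by
  rw [← inner_gradient_left, EuclideanSpace.inner_single_right]
  simp

lemma jacobianDet_eq_volForm (f : Fin k → RVec k → ℝ) (x : RVec k) :
    jacobianDet f x = volForm k fun i => ∇ (f i) x := by
  rw [jacobianDet, volForm_apply]
  simp only [gradient_apply_eq_fderiv]

lemma gradient_coord (x : RVec k) (i : Fin k) :
    ∇ (fun y : RVec k => y i) x = EuclideanSpace.single i 1 := by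
  refine HasGradientAt.gradient ?_
  rw [hasGradientAt_iff_hasFDerivAt]
  convert! (EuclideanSpace.proj (𝕜 := ℝ) i : RVec k →L[ℝ] ℝ).hasFDerivAt (x := x) using 1
  ext v
  simp [EuclideanSpace.inner_single_left]

lemma ContDiffOn.gradient {f : RVec k → ℝ} {s : Set (RVec k)} (hs : IsOpen s)
    (hf : ContDiffOn ℝ ∞ f s) : ContDiffOn ℝ ∞ (∇ f) s := by
  rw [contDiffOn_euclidean]
  intro i
  simp only [gradient_apply_eq_fderiv]
  exact (hf.fderiv_of_isOpen hs (by simp)).clm_apply contDiffOn_const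

lemma inner_hessian {F : RVec k → ℝ} {x : RVec k} (hF : DifferentiableAt ℝ (∇ F) x)
    (u w : RVec k) : inner ℝ (hessian F x u) w = fderiv ℝ (fderiv ℝ F) x u w := by
  have h1 : HasFDerivAt (fun y => innerSL ℝ (∇ F y))
      ((innerSL ℝ (E := RVec k)) ∘L hessian F x) x :=
    (innerSL ℝ (E := RVec k)).hasFDerivAt.comp x hF.hasFDerivAt
  have h2 : (fun y => innerSL ℝ (∇ F y)) = fderiv ℝ F := by
    ext y v; simp
  rw [h2] at h1
  rw [h1.fderiv]
  rfl

lemma hessian_symm {F : RVec k → ℝ} {s : Set (RVec k)} (hs : IsOpen s)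
    (hF : ContDiffOn ℝ ∞ F s) {x : RVec k} (hx : x ∈ s) (u w : RVec k) :
    inner ℝ (hessian F x u) w = inner ℝ u (hessian F x w) := by
  have hd : DifferentiableAt ℝ (∇ F) x :=
    ((hF.gradient hs).contDiffAt (hs.mem_nhds hx)).differentiableAt (by simp)
  rw [real_inner_comm (hessian F x w) u, inner_hessian hd, inner_hessian hd]
  exact (hF.contDiffAt (hs.mem_nhds hx)).isSymmSndFDerivAt
    (by rw [minSmoothness_of_isRCLikeNormedField]; exact WithTop.coe_le_coe.2 le_top) u w

lemma ContDiffOn.volForm {E : Type*} [NormedAddCommGroup E] [NormedSpace ℝ E] {s : Set E}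
    {v : E → Fin k → RVec k} (hv : ∀ i, ContDiffOn ℝ ∞ (fun y => v y i) s) :
    ContDiffOn ℝ ∞ (fun y => volForm k (v y)) s := by
  simp only [volForm_apply, Matrix.det_apply', Matrix.of_apply]
  exact ContDiffOn.sum fun σ _ => contDiffOn_const.mul
    (contDiffOn_prod fun i _ => (contDiffOn_euclidean.1 (hv _)) i)

/-- The squared norm of a decomposable multivector is the Gram determinant of its factors. -/
lemma wedge_ne_zero_iff {j : ℕ} {u : Fin j → RVec k} : wedge u ≠ 0 ↔ LinearIndependent ℝ u := by
  rw [← Matrix.det_gram_ne_zero_iff_linearIndependent (𝕜 := ℝ),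
    ← exteriorPower.inner_ιMulti_self, ne_eq, ne_eq, inner_self_eq_zero]

lemma inner_wedge_wedge {j : ℕ} (u v : Fin j → RVec k) :
    inner ℝ (wedge u) (wedge v) = Matrix.det (Matrix.of fun a b => inner ℝ (u a) (v b)) := by
  rw [wedge, wedge, exteriorPower.inner_ιMulti_ιMulti, ← Matrix.det_transpose]
  rfl

end

/-! ### Linearization and the two stability criteria -/

namespace HamiltonianRealization

open Filter Topology

variable {m : ℕ} (S : HamiltonianRealization m)

/-- The gradients `∇C₁, …, ∇C_{n-2}`. -/
abbrev gradC (x : RVec (m + 2)) : Fin m → RVec (m + 2) := fun i => ∇ (S.C i) x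

lemma X_eq (x : RVec (m + 2)) : S.X x = S.ν x • hodgeMap (S.gradC x) (∇ S.H x) := by
  ext i
  have h : (S.ν x • hodgeMap (S.gradC x) (∇ S.H x)) i =
      S.ν x * volBilin (S.gradC x) (EuclideanSpace.single i 1) (∇ S.H x) := by
    rw [← inner_hodgeMap_left, EuclideanSpace.inner_single_right]
    simp
  rw [h, volBilin_apply, ← gradient_coord x i, ← map_snoc₂ (fun f => ∇ f x),
    ← jacobianDet_eq_volForm]
  rfl

lemma contDiffOn_F (μ : RVec m) : ContDiffOn ℝ ∞ (S.F μ) S.Ω :=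
  S.contDiffOn_H.add (ContDiffOn.sum fun i _ => contDiffOn_const.mul (S.contDiffOn_C i))

lemma contDiffOn_gradH : ContDiffOn ℝ ∞ (∇ S.H) S.Ω := S.contDiffOn_H.gradient S.isOpen_Ω

lemma contDiffOn_gradC (i : Fin m) : ContDiffOn ℝ ∞ (∇ (S.C i)) S.Ω :=
  (S.contDiffOn_C i).gradient S.isOpen_Ω

variable {S}

lemma hasGradientAt_of_contDiffOn {f : RVec (m + 2) → ℝ} (hf : ContDiffOn ℝ ∞ f S.Ω)
    {x : RVec (m + 2)} (hx : x ∈ S.Ω) : HasGradientAt f (∇ f x) x :=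
  ((hf.contDiffAt (S.isOpen_Ω.mem_nhds hx)).differentiableAt (by simp)).hasGradientAt

lemma gradient_F (μ : RVec m) {x : RVec (m + 2)} (hx : x ∈ S.Ω) :
    ∇ (S.F μ) x = ∇ S.H x + ∑ i, μ i • ∇ (S.C i) x := by
  refine HasGradientAt.gradient ?_
  rw [hasGradientAt_iff_hasFDerivAt]
  have h1 := (hasGradientAt_of_contDiffOn S.contDiffOn_H hx).hasFDerivAt
  have h2 := fun i => ((hasGradientAt_of_contDiffOn (S.contDiffOn_C i) hx).hasFDerivAt).const_mul
    (μ i)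
  convert! h1.add (HasFDerivAt.fun_sum (u := Finset.univ) fun i _ => h2 i) using 1
  simp

lemma hasFDerivAt_gradient {f : RVec (m + 2) → ℝ} (hf : ContDiffOn ℝ ∞ f S.Ω)
    {x : RVec (m + 2)} (hx : x ∈ S.Ω) : HasFDerivAt (∇ f) (hessian f x) x :=
  (((hf.gradient S.isOpen_Ω).contDiffAt (S.isOpen_Ω.mem_nhds hx)).differentiableAt
    (by simp)).hasFDerivAt

lemma hessian_F (μ : RVec m) {x : RVec (m + 2)} (hx : x ∈ S.Ω) :
    hessian (S.F μ) x = hessian S.H x + ∑ i, μ i • hessian (S.C i) x := by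
  have h1 : (fun y => ∇ S.H y + ∑ i, μ i • ∇ (S.C i) y) =ᶠ[𝓝 x] ∇ (S.F μ) := by
    filter_upwards [S.isOpen_Ω.mem_nhds hx] with y hy
    rw [gradient_F μ hy]
  refine (h1.hasFDerivAt_iff.1 ?_).fderiv
  exact (hasFDerivAt_gradient S.contDiffOn_H hx).add (HasFDerivAt.fun_sum fun i _ =>
    (hasFDerivAt_gradient (S.contDiffOn_C i) hx).const_smul (μ i))

variable (S) in
/-- The operator field `ν(x) ⋆(∇C₁ ∧ ⋯ ∧ ∇C_{n-2} ∧ ·)`. -/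
def poissonMap (x : RVec (m + 2)) : RVec (m + 2) →L[ℝ] RVec (m + 2) :=
  S.ν x • hodgeMap (S.gradC x)

variable (S) in
lemma contDiffOn_poissonMap : ContDiffOn ℝ ∞ S.poissonMap S.Ω := by
  rw [contDiffOn_clm_apply]
  intro w
  refine S.contDiffOn_ν.smul ?_
  rw [contDiffOn_euclidean]
  intro i
  have h : ∀ x, hodgeMap (S.gradC x) w i =
      volForm (m + 2) (snoc₂ (S.gradC x) (EuclideanSpace.single i 1) w) := by
    intro x
    rw [← volBilin_apply, ← inner_hodgeMap_left, EuclideanSpace.inner_single_right]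
    simp
  refine ContDiffOn.congr (ContDiffOn.volForm fun j => ?_) fun x _ => h x
  simp only [snoc₂_eq_append]
  refine Fin.addCases (fun j => ?_) (fun j => ?_) j
  · simpa using S.contDiffOn_gradC j
  · simpa using contDiffOn_const

/-- The Poisson operator annihilates the gradients of the Casimirs, so `H` may be replaced by any
`F_μ`, in particular one that is critical at the equilibrium. -/
lemma X_eq_poissonMap (μ : RVec m) {x : RVec (m + 2)} (hx : x ∈ S.Ω) :
    S.X x = S.poissonMap x (∇ (S.F μ) x) := by
  rw [X_eq, gradient_F μ hx, poissonMap, map_add, map_sum]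
  simp [hodgeMap_mem]

variable (S) in
lemma contDiffOn_X : ContDiffOn ℝ ∞ S.X S.Ω := by
  have h : S.X = fun x => S.poissonMap x (∇ S.H x) := by
    ext1 x; rw [X_eq]; rfl
  rw [h]
  exact S.contDiffOn_poissonMap.clm_apply S.contDiffOn_gradH

/-- In the product rule, the derivative of the Poisson operator is applied to `∇F_μ(x) = 0` and
drops out. -/
lemma hasFDerivAt_X {μ : RVec m} {x : RVec (m + 2)} (hx : x ∈ S.Ω) (h0 : ∇ (S.F μ) x = 0) :
    HasFDerivAt S.X (S.poissonMap x ∘L hessian (S.F μ) x) x := by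
  have h1 : S.X =ᶠ[𝓝 x] fun y => S.poissonMap y (∇ (S.F μ) y) := by
    filter_upwards [S.isOpen_Ω.mem_nhds hx] with y hy
    exact X_eq_poissonMap μ hy
  refine h1.hasFDerivAt_iff.2 ?_
  have h2 := ((S.contDiffOn_poissonMap.contDiffAt (S.isOpen_Ω.mem_nhds hx)).differentiableAt
    (by simp)).hasFDerivAt
  have h3 := h2.clm_apply (hasFDerivAt_gradient (S.contDiffOn_F μ) hx)
  convert! h3 using 1
  ext1 v
  simp [h0]

lemma fderiv_C_X (i : Fin m) (x : RVec (m + 2)) : fderiv ℝ (S.C i) x (S.X x) = 0 := by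
  rw [← inner_gradient_left, X_eq, inner_smul_right, inner_hodgeMap_right,
    volBilin_left_mem (S.gradC x), mul_zero]

variable (S) in
lemma fderiv_H_X (x : RVec (m + 2)) : fderiv ℝ S.H x (S.X x) = 0 := by
  rw [← inner_gradient_left, X_eq, inner_smul_right, inner_hodgeMap_right, volBilin_self, mul_zero]

lemma invariant_eq (μ : RVec m) (x : RVec (m + 2)) :
    S.invariant μ x = S.ν x ^ 2 * ((hessian (S.F μ) x).det * Matrix.det (Matrix.of fun i j =>
      inner ℝ ((hessian (S.F μ) x).inverse (S.gradC x i)) (S.gradC x j))) := by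
  rw [invariant, inner_wedge_wedge, mul_assoc]

theorem isUnstableEquilibrium_of_invariant_neg {μ : RVec m} {x : RVec (m + 2)} (hx : x ∈ S.Ω)
    (hν : S.ν x ≠ 0) (hc : LinearIndependent ℝ (S.gradC x))
    (hcrit : IsNondegenerateCriticalPoint (S.F μ) x) (hI : S.invariant μ x < 0) :
    IsUnstableEquilibrium S.Ω S.X x := by
  have hX0 : S.X x = 0 := by rw [X_eq_poissonMap μ hx, hcrit.1, map_zero]
  refine ⟨hX0, ?_⟩
  have hsymm := hessian_symm S.isOpen_Ω (S.contDiffOn_F μ) hx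
  have hcube := hodgeMap_comp_cube hsymm hcrit.2 hc
  set A := hessian (S.F μ) x
  set σ := √(-S.invariant μ x)
  have hσ : 0 < σ := Real.sqrt_pos.2 (neg_pos.2 hI)
  have hσ2 : σ ^ 2 = -S.invariant μ x := Real.sq_sqrt (neg_pos.2 hI).le
  have hB : ∀ v, S.poissonMap x (A (S.poissonMap x (A (S.poissonMap x v)))) =
      σ ^ 2 • S.poissonMap x v := by
    intro v
    simp only [poissonMap, _root_.smul_apply, map_smul, hcube, smul_smul, hσ2, invariant_eq]
    congr 1
    ring
  refine not_isLyapunovStable_of_cube_eq S.isOpen_Ω hx hX0 (hasFDerivAt_X hx hcrit.1) hσ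
    (fun v => hB (A v)) ?_
  -- If `σ` were not an eigenvalue, invertibility of `A` would give `J A J = -σ J`. The left side is
  -- symmetric and `J` is skew, so `J = 0`, against `ν ≠ 0` and the independence of the gradients.
  by_contra! hB0
  have hsurj : ∀ v, S.poissonMap x (A (S.poissonMap x v)) = -σ • S.poissonMap x v := by
    intro v
    have := hB0 (A.inverse v)
    simp only [ContinuousLinearMap.comp_apply, A, apply_inverse_of_det_ne_zero hcrit.2] at this
    rw [neg_smul]
    exact eq_neg_of_add_eq_zero_left this
  obtain ⟨p, hp⟩ := exists_hodgeMap_ne_zero hc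
  have hskew : ∀ u w, inner ℝ (S.poissonMap x w) u = -inner ℝ w (S.poissonMap x u) := by
    intro u w
    simp only [poissonMap, _root_.smul_apply, inner_smul_left, inner_smul_right, hodgeMap_skew _ u]
    simp
  refine smul_ne_zero hν hp (ext_inner_right ℝ fun u => ?_)
  have h1 : inner ℝ (S.poissonMap x (A (S.poissonMap x p))) u =
      inner ℝ p (S.poissonMap x (A (S.poissonMap x u))) := by
    rw [hskew, hsymm, hskew, neg_neg]
  rw [hsurj, hsurj, inner_smul_left, inner_smul_right, hskew] at h1
  simp only [conj_trivial] at h1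
  have h2 : σ * inner ℝ p (S.poissonMap x u) = 0 := by linarith
  have h3 : inner ℝ (S.poissonMap x p) u = 0 := by
    rw [hskew, (mul_eq_zero.1 h2).resolve_left hσ.ne', neg_zero]
  rw [inner_zero_left]
  exact h3

theorem isLyapunovStable_of_invariant_pos {μ : RVec m} {x : RVec (m + 2)} (hx : x ∈ S.Ω)
    (hc : LinearIndependent ℝ (S.gradC x))
    (hcrit : IsNondegenerateCriticalPoint (S.F μ) x) (hI : 0 < S.invariant μ x) :
    IsLyapunovStable S.Ω S.X x := by
  have hX0 : S.X x = 0 := by rw [X_eq_poissonMap μ hx, hcrit.1, map_zero]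
  have hsymm := hessian_symm S.isOpen_Ω (S.contDiffOn_F μ) hx
  have hpos : 0 < (hessian (S.F μ) x).det * Matrix.det (Matrix.of fun i j =>
      inner ℝ ((hessian (S.F μ) x).inverse (S.gradC x i)) (S.gradC x j)) := by
    rw [invariant_eq] at hI
    exact pos_of_mul_pos_right hI (sq_nonneg _)
  have hlevel := eventually_eq_of_mem_levelSet (F := S.F μ) (C := S.C) (c := S.gradC x)
    (by
      filter_upwards [S.isOpen_Ω.mem_nhds hx] with y hy
      exact hasGradientAt_of_contDiffOn (S.contDiffOn_F μ) hy)
    hcrit.1 (hasFDerivAt_gradient (S.contDiffOn_F μ) hx) hsymm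
    (fun i => hasGradientAt_of_contDiffOn (S.contDiffOn_C i) hx)
    (fun p hp hp0 => inner_map_self_ne_zero_of_pos hsymm hcrit.2 hc hpos hp hp0)
  have hd : ∀ {f : RVec (m + 2) → ℝ}, ContDiffOn ℝ ∞ f S.Ω → ∀ y ∈ S.Ω,
      HasFDerivAt (fun z => (f z - f x) ^ 2) ((2 * (f y - f x)) • fderiv ℝ f y) y := by
    intro f hf y hy
    have h1 := ((hf.contDiffAt (S.isOpen_Ω.mem_nhds hy)).differentiableAt (by simp)).hasFDerivAt
    simpa using! (h1.sub_const (f x)).pow 2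
  have hG : ∀ y ∈ S.Ω, HasFDerivAt
      (fun z => (S.H z - S.H x) ^ 2 + ∑ i, (S.C i z - S.C i x) ^ 2)
      ((2 * (S.H y - S.H x)) • fderiv ℝ S.H y +
        ∑ i, (2 * (S.C i y - S.C i x)) • fderiv ℝ (S.C i) y) y := fun y hy =>
    (hd S.contDiffOn_H y hy).add (HasFDerivAt.fun_sum fun i _ => hd (S.contDiffOn_C i) y hy)
  -- A zero of this `G` shares the values of `H` and all `C i` with `x`, hence also that of `F_μ`,
  -- and the isolation result applies.
  refine isLyapunovStable_of_firstIntegral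
    (G := fun z => (S.H z - S.H x) ^ 2 + ∑ i, (S.C i z - S.C i x) ^ 2)
    S.isOpen_Ω hx hX0 (S.contDiffOn_X.of_le (by simp))
    (fun y hy => (hG y hy).differentiableAt.differentiableWithinAt) (fun y hy => ?_) (by simp)
    (fun y => by positivity) ?_
  · rw [(hG y hy).fderiv]
    simp [fderiv_C_X, fderiv_H_X]
  · filter_upwards [hlevel] with y hy hy0
    have hsum : 0 ≤ ∑ i, (S.C i y - S.C i x) ^ 2 := by positivity
    have hH : S.H y = S.H x := by
      have : (S.H y - S.H x) ^ 2 = 0 := by linarith [sq_nonneg (S.H y - S.H x)]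
      exact sub_eq_zero.1 (pow_eq_zero_iff two_ne_zero |>.1 this)
    have hC : ∀ i, S.C i y = S.C i x := by
      have : ∑ i, (S.C i y - S.C i x) ^ 2 = 0 := by linarith [sq_nonneg (S.H y - S.H x)]
      intro i
      have h1 := (Finset.sum_eq_zero_iff_of_nonneg fun i _ => sq_nonneg _).1 this i
        (Finset.mem_univ i)
      exact sub_eq_zero.1 (pow_eq_zero_iff two_ne_zero |>.1 h1)
    exact hy (by simp [F, hH, hC]) hC

end HamiltonianRealization

/-! ### Smooth implicit functions on a neighbourhood -/

section

open Filter Topology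

/-- The smooth implicit function theorem, with smoothness on a whole neighbourhood. -/
lemma exists_contDiffOn_implicitFunction {E₁ E₂ F : Type*} [NormedAddCommGroup E₁]
    [NormedSpace ℝ E₁] [CompleteSpace E₁] [NormedAddCommGroup E₂] [NormedSpace ℝ E₂]
    [CompleteSpace E₂] [NormedAddCommGroup F] [NormedSpace ℝ F] [CompleteSpace F]
    {f : E₁ × E₂ → F} {s : Set (E₁ × E₂)} {u : E₁ × E₂} (hs : IsOpen s) (hu : u ∈ s)
    (hf : ContDiffOn ℝ ∞ f s) (hinv : (fderiv ℝ f u ∘L .inr ℝ E₁ E₂).IsInvertible) :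
    ∃ (V : Set E₁) (ψ : E₁ → E₂), IsOpen V ∧ u.1 ∈ V ∧ ψ u.1 = u.2 ∧ ContDiffOn ℝ ∞ ψ V ∧
      ∀ x ∈ V, (x, ψ x) ∈ s ∧ f (x, ψ x) = f u := by
  have hne : (∞ : WithTop ℕ∞) ≠ 0 := by simp
  have hfa : ∀ v ∈ s, ContDiffAt ℝ ∞ f v := fun v hv => hf.contDiffAt (hs.mem_nhds hv)
  set ψ := (hfa u hu).implicitFunction hne hinv with hψ
  have hψu : ψ u.1 = u.2 := (hfa u hu).implicitFunction_apply_self hne hinv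
  have hψd : ContDiffAt ℝ ∞ ψ u.1 := (hfa u hu).contDiffAt_implicitFunction hne hinv
  have hψc : ∀ᶠ x in 𝓝 u.1, ContinuousAt ψ x :=
    ((hψd.of_le (m := 1) (by simp)).eventually (by simp)).mono fun x hx => hx.continuousAt
  have hpair : ∀ x, ContinuousAt ψ x → ContinuousAt (fun y => (y, ψ y)) x := fun x hx =>
    continuousAt_id.prodMk hx
  have hpu : ContinuousAt (fun y => (y, ψ y)) u.1 := hpair _ hψd.continuousAt
  have hsV : ∀ᶠ x in 𝓝 u.1, (x, ψ x) ∈ s :=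
    hpu.eventually_mem (hs.mem_nhds (by simpa [hψu] using hu))
  have hzero : ∀ᶠ x in 𝓝 u.1, f (x, ψ x) = f u :=
    (hfa u hu).eventually_apply_implicitFunction hne hinv
  have hinvV : ∀ᶠ x in 𝓝 u.1, (fderiv ℝ f (x, ψ x) ∘L .inr ℝ E₁ E₂).IsInvertible := by
    obtain ⟨e, he⟩ := hinv
    have h1 : ContinuousAt (fun v => fderiv ℝ f v ∘L .inr ℝ E₁ E₂) (u.1, ψ u.1) := by
      rw [hψu]
      exact (((hfa u hu).fderiv_right (m := 0) (by simp)).continuousAt).clm_comp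
        continuousAt_const
    have h2 := (ContinuousAt.comp (f := fun y => (y, ψ y)) h1 hpu).eventually_mem
      (s := Set.range ((↑) : (E₂ ≃L[ℝ] F) → (E₂ →L[ℝ] F)))
      (by
        simp only [Function.comp_apply, hψu]
        rw [← he]
        exact ContinuousLinearEquiv.nhds e)
    exact h2
  have hall := (hψc.and (hsV.and (hinvV.and hzero))).and
    (eventually_eventually_nhds.2 hzero)
  obtain ⟨V, hV, hVo, huV⟩ := eventually_nhds_iff.1 hall
  refine ⟨V, ψ, hVo, huV, hψu, fun x hx => ContDiffAt.contDiffWithinAt ?_,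
    fun x hx => ⟨(hV x hx).1.2.1, (hV x hx).1.2.2.2⟩⟩
  -- `ContDiffAt ℝ ∞` at the base point yields only finite orders on neighbourhoods that may shrink
  -- with the order. The implicit function theorem is therefore applied afresh at each nearby point,
  -- and local uniqueness identifies its solution with `ψ`.
  obtain ⟨⟨hxc, hxs, hxi, hx0⟩, hxz⟩ := hV x hx
  have h1 := (hpair x hxc).eventually
    ((hfa _ hxs).eventually_apply_eq_iff_implicitFunction hne hxi)
  refine ((hfa _ hxs).contDiffAt_implicitFunction hne hxi).congr_of_eventuallyEq ?_
  filter_upwards [h1, hxz] with y hy hyz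
  exact (hy.1 (hyz.trans hx0.symm)).symm

end

/-! ### The branch of equilibria -/

namespace HamiltonianRealization

open Filter Topology

variable {m : ℕ} {S : HamiltonianRealization m}

/-- The partial derivative in `x` of `(μ, x) ↦ ∇F_μ(x)` is the Hessian, invertible by
non-degeneracy. -/
lemma exists_branch {μ₀ : RVec m} {x₀ : RVec (m + 2)} (hx₀ : x₀ ∈ S.Ω)
    (hcrit : IsNondegenerateCriticalPoint (S.F μ₀) x₀) :
    ∃ (V : Set (RVec m)) (ψ : RVec m → RVec (m + 2)), IsOpen V ∧ μ₀ ∈ V ∧ ψ μ₀ = x₀ ∧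
      ContDiffOn ℝ ∞ ψ V ∧ ∀ μ ∈ V, ψ μ ∈ S.Ω ∧ ∇ (S.F μ) (ψ μ) = 0 := by
  set g : RVec m × RVec (m + 2) → RVec (m + 2) := fun u =>
    ∇ S.H u.2 + ∑ i, u.1 i • ∇ (S.C i) u.2 with hg
  have hs : IsOpen ((Set.univ : Set (RVec m)) ×ˢ S.Ω) := isOpen_univ.prod S.isOpen_Ω
  have hmap : Set.MapsTo Prod.snd ((Set.univ : Set (RVec m)) ×ˢ S.Ω) S.Ω := fun u hu => hu.2
  have hgd : ContDiffOn ℝ ∞ g (Set.univ ×ˢ S.Ω) := by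
    refine (S.contDiffOn_gradH.comp contDiffOn_snd hmap).add (ContDiffOn.sum fun i _ => ?_)
    have hi : ContDiffOn ℝ ∞ (fun u : RVec m × RVec (m + 2) => u.1 i) (Set.univ ×ˢ S.Ω) :=
      contDiffOn_euclidean.1 contDiffOn_fst i
    exact hi.smul ((S.contDiffOn_gradC i).comp contDiffOn_snd hmap)
  have hu : (μ₀, x₀) ∈ (Set.univ : Set (RVec m)) ×ˢ S.Ω := ⟨trivial, hx₀⟩
  have hpart : fderiv ℝ g (μ₀, x₀) ∘L .inr ℝ (RVec m) (RVec (m + 2)) =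
      hessian (S.F μ₀) x₀ := by
    have h1 := ((hgd.contDiffAt (hs.mem_nhds hu)).differentiableAt (by simp)).hasFDerivAt
    have h2 : HasFDerivAt (fun y => (μ₀, y)) (.inr ℝ (RVec m) (RVec (m + 2))) x₀ :=
      hasFDerivAt_prodMk_right μ₀ x₀
    have h3 : (fun y => g (μ₀, y)) =ᶠ[𝓝 x₀] ∇ (S.F μ₀) := by
      filter_upwards [S.isOpen_Ω.mem_nhds hx₀] with y hy
      rw [gradient_F μ₀ hy]
    have h4 : HasFDerivAt (∇ (S.F μ₀)) _ x₀ := h3.hasFDerivAt_iff.1 (h1.comp x₀ h2)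
    exact h4.fderiv.symm
  obtain ⟨V, ψ, hV, hμV, hψ, hψd, hψV⟩ := exists_contDiffOn_implicitFunction hs hu hgd
    (by
      rw [hpart]
      exact ⟨_, (hessian (S.F μ₀) x₀).coe_toContinuousLinearEquivOfDetNeZero hcrit.2⟩)
  refine ⟨V, ψ, hV, hμV, hψ, hψd, fun μ hμ => ⟨(hψV μ hμ).1.2, ?_⟩⟩
  rw [gradient_F μ (hψV μ hμ).1.2]
  have h0 : g (μ₀, x₀) = 0 := by
    rw [← hcrit.1, gradient_F μ₀ hx₀]
  exact (hψV μ hμ).2.trans h0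

lemma continuousAt_hessian {f : RVec (m + 2) → ℝ} (hf : ContDiffOn ℝ ∞ f S.Ω)
    {x : RVec (m + 2)} (hx : x ∈ S.Ω) : ContinuousAt (hessian f) x :=
  (((hf.gradient S.isOpen_Ω).contDiffAt (S.isOpen_Ω.mem_nhds hx)).fderiv_right (m := 0)
    (by simp)).continuousAt

lemma continuousAt_hessian_F_comp {μ₀ : RVec m} {ψ : RVec m → RVec (m + 2)}
    (hψ : ContinuousAt ψ μ₀) (hΩ : ψ μ₀ ∈ S.Ω) :
    ContinuousAt (fun μ => hessian (S.F μ) (ψ μ)) μ₀ := by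
  have h1 : (fun μ => hessian (S.F μ) (ψ μ)) =ᶠ[𝓝 μ₀]
      fun μ => hessian S.H (ψ μ) + ∑ i, μ i • hessian (S.C i) (ψ μ) := by
    filter_upwards [hψ.eventually_mem (S.isOpen_Ω.mem_nhds hΩ)] with μ hμ
    exact hessian_F μ hμ
  refine ContinuousAt.congr ?_ h1.symm
  refine (ContinuousAt.comp (f := ψ) (continuousAt_hessian S.contDiffOn_H hΩ) hψ).add
    (tendsto_finsetSum _ fun i _ => ?_)
  have hi : ContinuousAt (fun μ : RVec m => μ i) μ₀ := by fun_prop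
  exact hi.smul
    (ContinuousAt.comp (f := ψ) (continuousAt_hessian (S.contDiffOn_C i) hΩ) hψ)

lemma continuousAt_gradC_comp {μ₀ : RVec m} {ψ : RVec m → RVec (m + 2)}
    (hψ : ContinuousAt ψ μ₀) (hΩ : ψ μ₀ ∈ S.Ω) (i : Fin m) :
    ContinuousAt (fun μ => S.gradC (ψ μ) i) μ₀ :=
  ContinuousAt.comp (f := ψ) ((S.contDiffOn_gradC i).contDiffAt
    (S.isOpen_Ω.mem_nhds hΩ)).continuousAt hψ

lemma continuousAt_ν_comp {μ₀ : RVec m} {ψ : RVec m → RVec (m + 2)}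
    (hψ : ContinuousAt ψ μ₀) (hΩ : ψ μ₀ ∈ S.Ω) : ContinuousAt (fun μ => S.ν (ψ μ)) μ₀ :=
  ContinuousAt.comp (f := ψ) (S.contDiffOn_ν.contDiffAt
    (S.isOpen_Ω.mem_nhds hΩ)).continuousAt hψ

lemma continuousAt_det_of {X : Type*} [TopologicalSpace X] {a : X} {n : Type*} [Fintype n]
    [DecidableEq n] {f : X → n → n → ℝ} (hf : ∀ i j, ContinuousAt (fun x => f x i j) a) :
    ContinuousAt (fun x => Matrix.det (Matrix.of (f x))) a :=
  ContinuousAt.comp (f := fun x => Matrix.of (f x)) (continuous_id.matrix_det).continuousAt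
    (continuousAt_pi.2 fun i => continuousAt_pi.2 fun j => hf i j)

lemma continuousAt_invariant_comp {μ₀ : RVec m} {ψ : RVec m → RVec (m + 2)}
    (hψ : ContinuousAt ψ μ₀) (hΩ : ψ μ₀ ∈ S.Ω) (hdet : (hessian (S.F μ₀) (ψ μ₀)).det ≠ 0) :
    ContinuousAt (fun μ => S.invariant μ (ψ μ)) μ₀ := by
  simp only [invariant_eq]
  have hA := continuousAt_hessian_F_comp hψ hΩ
  have hinv : (hessian (S.F μ₀) (ψ μ₀)).IsInvertible :=
    ⟨_, (hessian (S.F μ₀) (ψ μ₀)).coe_toContinuousLinearEquivOfDetNeZero hdet⟩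
  have hAinv : ContinuousAt (fun μ => (hessian (S.F μ) (ψ μ)).inverse) μ₀ :=
    ContinuousAt.comp (f := fun μ => hessian (S.F μ) (ψ μ))
      (hinv.contDiffAt_map_inverse (n := 0)).continuousAt hA
  refine ((continuousAt_ν_comp hψ hΩ).pow 2).mul
    (ContinuousAt.mul ?_ (continuousAt_det_of fun i j => ?_))
  · exact ContinuousAt.comp (f := fun μ => hessian (S.F μ) (ψ μ))
      ContinuousLinearMap.continuous_det.continuousAt hA
  · exact (hAinv.clm_apply (continuousAt_gradC_comp hψ hΩ i)).inner
      (continuousAt_gradC_comp hψ hΩ j)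

/-- The branch of regular equilibria through a non-degenerate regular equilibrium, along which
every open condition on the invariant persists. -/
lemma exists_branch_of_isOpen {I : Set ℝ} (hI : IsOpen I) {μ₀ : RVec m} {x₀ : RVec (m + 2)}
    (hx₀ : x₀ ∈ S.regularEquilibria) (hcrit : IsNondegenerateCriticalPoint (S.F μ₀) x₀)
    (hinv : S.invariant μ₀ x₀ ∈ I) :
    ∃ (V : Set (RVec m)) (U : Set (RVec (m + 2))) (ψ : RVec m → RVec (m + 2)),
      IsOpen V ∧ μ₀ ∈ V ∧ IsOpen U ∧ U ⊆ S.Ω ∧ x₀ ∈ U ∧ ContDiffOn ℝ ∞ ψ V ∧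
      Set.MapsTo ψ V U ∧ ψ μ₀ = x₀ ∧ ∀ μ ∈ V,
        S.IsNondegenerateRegularEquilibrium (ψ μ) ∧
        IsNondegenerateCriticalPoint (S.F μ) (ψ μ) ∧ S.invariant μ (ψ μ) ∈ I := by
  obtain ⟨hΩ, hν, hC, -⟩ := hx₀
  obtain ⟨V, ψ, hV, hμV, rfl, hψd, hψV⟩ := exists_branch hΩ hcrit
  have hψ : ContinuousAt ψ μ₀ := (hψd.contDiffAt (hV.mem_nhds hμV)).continuousAt
  have hνe : ∀ᶠ μ in 𝓝 μ₀, S.ν (ψ μ) ≠ 0 := (continuousAt_ν_comp hψ hΩ).eventually_ne hν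
  have hCe : ∀ᶠ μ in 𝓝 μ₀, LinearIndependent ℝ (S.gradC (ψ μ)) := by
    rw [wedge_ne_zero_iff, ← Matrix.det_gram_ne_zero_iff_linearIndependent (𝕜 := ℝ)] at hC
    have h1 : ContinuousAt (fun μ => (Matrix.gram ℝ (S.gradC (ψ μ))).det) μ₀ :=
      continuousAt_det_of fun i j =>
        (continuousAt_gradC_comp hψ hΩ i).inner (continuousAt_gradC_comp hψ hΩ j)
    filter_upwards [h1.eventually_ne hC] with μ hμ
    exact Matrix.det_gram_ne_zero_iff_linearIndependent.1 hμ
  have hde : ∀ᶠ μ in 𝓝 μ₀, (hessian (S.F μ) (ψ μ)).det ≠ 0 :=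
    (ContinuousAt.comp (f := fun μ => hessian (S.F μ) (ψ μ))
      ContinuousLinearMap.continuous_det.continuousAt
      (continuousAt_hessian_F_comp hψ hΩ)).eventually_ne hcrit.2
  have hIe : ∀ᶠ μ in 𝓝 μ₀, S.invariant μ (ψ μ) ∈ I :=
    (continuousAt_invariant_comp hψ hΩ hcrit.2).eventually_mem (hI.mem_nhds hinv)
  obtain ⟨W, hW, hWo, hμW⟩ := eventually_nhds_iff.1 (hνe.and (hCe.and (hde.and hIe)))
  refine ⟨V ∩ W, S.Ω, ψ, hV.inter hWo, ⟨hμV, hμW⟩, S.isOpen_Ω, subset_rfl, hΩ,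
    hψd.mono Set.inter_subset_left, fun μ hμ => (hψV μ hμ.1).1, rfl, fun μ hμ => ?_⟩
  obtain ⟨hνμ, hCμ, hdμ, hIμ⟩ := hW μ hμ.2
  obtain ⟨hΩμ, hμ0⟩ := hψV μ hμ.1
  refine ⟨⟨⟨hΩμ, hνμ, wedge_ne_zero_iff.2 hCμ, ?_⟩, μ, hμ0, hdμ⟩, ⟨hμ0, hdμ⟩, hIμ⟩
  -- Criticality puts `∇H` in the span of the `∇Cᵢ`, so the wedge of all the gradients must vanish.
  by_contra hw
  refine (linearIndependent_finSnoc.1 (wedge_ne_zero_iff.1 hw)).2 ?_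
  rw [gradient_F μ hΩμ] at hμ0
  rw [eq_neg_of_add_eq_zero_left hμ0]
  exact neg_mem (sum_mem fun i _ => Submodule.smul_mem _ _ (Submodule.subset_span ⟨i, rfl⟩))

end HamiltonianRealization

end

theorem theorem5p9 {m : ℕ} (S : HamiltonianRealization m)
    (xe : RVec (m + 2)) (hxe : S.IsNondegenerateRegularEquilibrium xe)
    (lame : RVec m) (hlame : IsNondegenerateCriticalPoint (S.F lame) xe) :
    (S.invariant lame xe < 0 →
      ∃ (V : Set (RVec m)) (U : Set (RVec (m + 2))) (xbar : RVec m → RVec (m + 2)),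
        IsOpen V ∧ lame ∈ V ∧ IsOpen U ∧ U ⊆ S.Ω ∧ xe ∈ U ∧
        ContDiffOn ℝ ∞ xbar V ∧ Set.MapsTo xbar V U ∧ xbar lame = xe ∧
        ∀ lam ∈ V,
          S.IsNondegenerateRegularEquilibrium (xbar lam) ∧
          IsNondegenerateCriticalPoint (S.F lam) (xbar lam) ∧
          IsUnstableEquilibrium S.Ω S.X (xbar lam)) ∧
    (0 < S.invariant lame xe →
      ∃ (V : Set (RVec m)) (U : Set (RVec (m + 2))) (xbar : RVec m → RVec (m + 2)),
        IsOpen V ∧ lame ∈ V ∧ IsOpen U ∧ U ⊆ S.Ω ∧ xe ∈ U ∧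
        ContDiffOn ℝ ∞ xbar V ∧ Set.MapsTo xbar V U ∧ xbar lame = xe ∧
        ∀ lam ∈ V,
          S.IsNondegenerateRegularEquilibrium (xbar lam) ∧
          IsNondegenerateCriticalPoint (S.F lam) (xbar lam) ∧
          IsLyapunovStable S.Ω S.X (xbar lam)) := by
  constructor
  · intro hI
    obtain ⟨V, U, ψ, hV, hlV, hU, hUΩ, hxU, hψ, hmaps, hψe, hall⟩ :=
      HamiltonianRealization.exists_branch_of_isOpen isOpen_Iio hxe.1 hlame hI
    refine ⟨V, U, ψ, hV, hlV, hU, hUΩ, hxU, hψ, hmaps, hψe, fun lam hlam => ?_⟩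
    obtain ⟨hreg, hcrit, hinv⟩ := hall lam hlam
    exact ⟨hreg, hcrit, HamiltonianRealization.isUnstableEquilibrium_of_invariant_neg hreg.1.1
      hreg.1.2.1 (wedge_ne_zero_iff.1 hreg.1.2.2.1) hcrit hinv⟩
  · intro hI
    obtain ⟨V, U, ψ, hV, hlV, hU, hUΩ, hxU, hψ, hmaps, hψe, hall⟩ :=
      HamiltonianRealization.exists_branch_of_isOpen isOpen_Ioi hxe.1 hlame hI
    refine ⟨V, U, ψ, hV, hlV, hU, hUΩ, hxU, hψ, hmaps, hψe, fun lam hlam => ?_⟩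
    obtain ⟨hreg, hcrit, hinv⟩ := hall lam hlam
    exact ⟨hreg, hcrit, HamiltonianRealization.isLyapunovStable_of_invariant_pos hreg.1.1
      (wedge_ne_zero_iff.1 hreg.1.2.2.1) hcrit hinv⟩
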